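/- **Setting.** Let $d\in\mathbb N$, $\gamma>0$, $\sigma\ge 0$, $0\le H<\infty$, and put $h(t)=\min(t,H)$. Let $A\colon\mathbb R^d\to\mathbb R^d$ be of the form $A(x)=-x+g(x)$ with $|g(x)-g(y)|\le c_g|x-y|$, and let $B\colon\mathbb R^d\times\mathbb R^d\to\mathbb R^d$ satisfy $$|B(x,\hat x)-B(y,\hat x)|+|B(x,\hat x)-B(x,\hat y)|\le c_B\big(|x-y|+|\hat x-\hat y|\big)\qquad\text{for all }x,y,\hat x,\hat y\in\mathbb R^d,$$ with constants $c_g,c_B\ge 0$; put $\eta:=c_g+2c_B$. Let $\mathcal P_2(\mathbb R^{2d})$ be the set of Borel probability measures on $\mathbb R^{2d}$ with finite second moment, with the Wasserstein distance $\mathrm{dist}_2$. A *solution* of the delay mean-field equation is a curve $\mu\in C([0,\infty),\mathcal P_2(\mathbb R^{2d}))$ such that $\mu_t=\mathrm{law}(X_t,V_t)$ for all $t\ge 0$, where $(X_t,V_t)_{t\ge0}$ is a continuous process, on some probability space, with $$dX_t=V_t\,dt,\qquad dV_t=A(X_t)\,dt+\Big(\frac1{h(t)}\int_{t-h(t)}^{t}\int_{\mathbb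 R^d}B(X_t,\hat x)\,\rho_s(d\hat x)\,ds\Big)dt-\gamma V_t\,dt+\sqrt{2\sigma}\,dW_t ,$$ $W$ is a standard Brownian motion in $\mathbb R^d$ independent of $(X_0,V_0)$, and $\rho_s$ is the first ($x$-)marginal of $\mu_s$. When $h(t)=0$ the time average is read as its limit $\int B(X_t,\hat x)\,\rho_t(d\hat x)$ (for $H=0$ this is the equation without delay). For $Q(x,v)=a|x|^2+2\langle x,v\rangle+b|v|^2$ positive definite on $\mathbb R^{2d}$ let $$\mathrm{dist}_Q(\mu,\hat\mu)^2=\inf_{\pi}\int Q(z-\hat z)\,\pi(dz,d\hat z),$$ the infimum being over all couplings $\pi$ of $\mu$ and $\hat\mu$. **Theorem.** For every $\gamma>0$ there are constants $a,b,\eta_0>0$, depending only on $\gamma$, such that the quadratic form $Q(x,v)=a|x|^2+2\langle x,v\rangle+b|v|^2$ is positive definite (on $\mathbb R^{2d}$, for every $d$) and the following holds whenever $c_g,c_B\ge0$, $\eta=c_g+2c_B<\eta_0$ and $0\le H<\infty$. Put $$\lambda_1=\gamma-\Big(1+\frac{2\gamma}{4+\gamma^2}\Big)\eta-\frac{\gamma}{4+\gamma^2}\sqrt{4\eta^2+(4+\gamma^2)(\gamma-\eta)^2},\qquad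 \lambda_2=\frac{(2+\gamma)^2}{(1+\gamma)(4+\gamma^2)}\,\frac{\eta}{2},$$ $$\lambda=\lambda_1-\frac1H\,W\big(\lambda_2He^{\lambda_1H}\big),$$ where $W$ is the principal branch of the Lambert function, $W(z)e^{W(z)}=z$, and for $H=0$ the rate is read as its limit $\lambda=\lambda_1-\lambda_2$. Then $\lambda>0$, and for all $d$, $\sigma$, $A$, $B$ as above and any two solutions $(\mu_t)_{t\ge0}$, $(\hat\mu_t)_{t\ge0}$ of the delay mean-field equation, $$\mathrm{dist}_Q(\mu_t,\hat\mu_t)^2\le e^{-\lambda t}\,\mathrm{dist}_Q(\mu_0,\hat\mu_0)^2\qquad\text{for all }t\ge0 .$$ -/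

import Mathlib

open MeasureTheory ProbabilityTheory Filter Set
open scoped ENNReal NNReal Topology

universe u v

namespace DelayVFP

noncomputable section

/-- Positions and velocities live in Euclidean space `ℝ^d`. -/
abbrev Space (d : ℕ) : Type := EuclideanSpace ℝ (Fin d)

/-- The state space `ℝ^{2d}` of pairs `(x, v)`. (Its Euclidean length is always written out
explicitly, see `sqLength`; the sup norm of the product type is never used.) -/
abbrev Phase (d : ℕ) : Type := Space d × Space d

/-- `|z|² = |x|² + |v|²` for `z = (x, v)`. -/
def sqLength {d : ℕ} (z : Phase d) : ℝ := ‖z.1‖ ^ 2 + ‖z.2‖ ^ 2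

/-- `Q(x, v) = a |x|² + 2 ⟨x, v⟩ + b |v|²`. -/
def quadForm (a b : ℝ) {d : ℕ} (z : Phase d) : ℝ :=
  a * ‖z.1‖ ^ 2 + 2 * inner ℝ z.1 z.2 + b * ‖z.2‖ ^ 2

/-! ### Couplings and transport distances -/

/-- Couplings of `μ` and `ν`. -/
def couplings {d : ℕ} (μ ν : Measure (Phase d)) : Set (Measure (Phase d × Phase d)) :=
  {π | π.map Prod.fst = μ ∧ π.map Prod.snd = ν}

/-- The distance given by
`dist(μ, ν)² = inf_π ∫ c(z - ẑ) dπ(z, ẑ)` over all couplings `π` of `μ` and `ν`,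
for a nonnegative cost `c`. -/
def transportDist {d : ℕ} (c : Phase d → ℝ) (μ ν : Measure (Phase d)) : ℝ≥0∞ :=
  (⨅ π ∈ couplings μ ν, ∫⁻ p, ENNReal.ofReal (c (p.1 - p.2)) ∂π) ^ (1 / 2 : ℝ)

/-- The Wasserstein distance `dist_2`. -/
def distTwo {d : ℕ} (μ ν : Measure (Phase d)) : ℝ≥0∞ := transportDist sqLength μ ν

/-- The distance `dist_Q` of the quadratic form `Q(x, v) = a |x|² + 2 ⟨x, v⟩ + b |v|²`. -/
def distQ (a b : ℝ) {d : ℕ} (μ ν : Measure (Phase d)) : ℝ≥0∞ :=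
  transportDist (quadForm a b) μ ν

/-- Membership in `P_2(ℝ^{2d})`: probability measures with finite second moment. -/
def MemP2 {d : ℕ} (μ : Measure (Phase d)) : Prop :=
  IsProbabilityMeasure μ ∧ Integrable sqLength μ

/-- `μ ∈ C([0, ∞), P_2(ℝ^{2d}))`, where `P_2` carries the distance `dist_2`. Only the values
`μ t` with `t ≥ 0` matter. -/
def IsContinuousCurve {d : ℕ} (μ : ℝ → Measure (Phase d)) : Prop :=
  (∀ t, 0 ≤ t → MemP2 (μ t)) ∧
    ∀ t, 0 ≤ t → Tendsto (fun s => distTwo (μ s) (μ t)) (𝓝[Ici 0] t) (𝓝 0)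

/-! ### The coefficients -/

/-- `A(x) = -α x + g(x)` with `α > 0` and `g` Lipschitz with constant `c_g`, and `B` is Lipschitz
in each variable in the sense of the displayed inequality, with constant `c_B`. -/
structure CoefficientAssumption {d : ℕ} (α cg cB : ℝ) (A : Space d → Space d)
    (B : Space d → Space d → Space d) : Prop where
  alpha_pos : 0 < α
  force : ∃ g : Space d → Space d,
    (∀ x, A x = -(α • x) + g x) ∧ ∀ x y, ‖g x - g y‖ ≤ cg * ‖x - y‖
  interaction : ∀ x y x' y' : Space d,
    ‖B x x' - B y x'‖ + ‖B x x' - B x y'‖ ≤ cB * (‖x - y‖ + ‖x' - y'‖)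

/-! ### The delay mean-field equation -/

/-- The cut-off `h(t)`: equal to `t` for `t ≤ H` and to `H` for `t > H`. -/
def cutoff (H t : ℝ) : ℝ := min t H

/-- `(1 / h(t)) ∫_{t - h(t)}^t F(s) ds`, read as its limit `F(t)` when `h(t) = 0`
(that is, at `t = 0`, and at all times in the equation without delay, `H = 0`). -/
def delayAverage {d : ℕ} (H : ℝ) (F : ℝ → Space d) (t : ℝ) : Space d :=
  if cutoff H t = 0 then F t
  else (1 / cutoff H t) • ∫ s in (t - cutoff H t)..t, F s

/-- The interaction force
`(1 / h(t)) ∫_{t - h(t)}^t ∫ B(x, y) ρ_s(dy) ds`, with `ρ_s` the first marginal of `μ_s`. -/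
def interactionForce {d : ℕ} (H : ℝ) (B : Space d → Space d → Space d)
    (μ : ℝ → Measure (Phase d)) (t : ℝ) (x : Space d) : Space d :=
  delayAverage H (fun s => ∫ y, B x y ∂(μ s).fst) t

/-- A standard Brownian motion in `ℝ^d`: its coordinates are independent real standard Brownian
motions. -/
structure IsBrownian {Ω : Type u} [MeasurableSpace Ω] {d : ℕ} (W : ℝ≥0 → Ω → Space d)
    (P : Measure Ω) : Prop where
  measurable : ∀ t, Measurable (W t)
  coord : ∀ i : Fin d, IsBrownianReal (fun t ω => W t ω i) P
  indep : iIndepFun (fun (i : Fin d) (ω : Ω) (t : ℝ≥0) => W t ω i) P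

/-- `(X, V)` is a solution, driven by the Brownian motion `W` and with coefficient measures `μ`, of
`dX = V dt`,
`dV = A(X) dt + (1 / h(t)) ∫_{t - h(t)}^t ∫ B(X_t, y) ρ_s(dy) ds dt - γ V dt + √(2σ) dW`.
The noise is additive, so the equation is stated pathwise in integrated form. The initial state is
independent of `W`. Only times `t ≥ 0` matter. -/
structure IsSolutionProcess {Ω : Type u} [MeasurableSpace Ω] {d : ℕ} (P : Measure Ω)
    (γ σ H : ℝ) (A : Space d → Space d) (B : Space d → Space d → Space d)
    (μ : ℝ → Measure (Phase d)) (W : ℝ≥0 → Ω → Space d) (X V : ℝ → Ω → Space d) : Prop where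
  brownian : IsBrownian W P
  measurable_X : ∀ t, 0 ≤ t → Measurable (X t)
  measurable_V : ∀ t, 0 ≤ t → Measurable (V t)
  initial_indep : IndepFun (fun ω => (X 0 ω, V 0 ω)) (fun ω (t : ℝ≥0) => W t ω) P
  continuous_paths : ∀ᵐ ω ∂P,
    ContinuousOn (fun t => X t ω) (Ici 0) ∧ ContinuousOn (fun t => V t ω) (Ici 0)
  position : ∀ᵐ ω ∂P, ∀ t : ℝ≥0, X t ω = X 0 ω + ∫ s in (0 : ℝ)..t, V s ω
  velocity : ∀ᵐ ω ∂P, ∀ t : ℝ≥0,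
    V t ω = V 0 ω
      + (∫ s in (0 : ℝ)..t, (A (X s ω) + interactionForce H B μ s (X s ω) - γ • V s ω))
      + √(2 * σ) • W t ω

/-- `(μ_t)_{t ≥ 0}` is a solution of the delay mean-field equation: a continuous curve in `P_2`
for which there is a process `(X, V)`, on some probability space, that solves the McKean type
equation with coefficient measures `μ` and has `law (X_t, V_t) = μ_t` for all `t ≥ 0`. -/
def IsMeanFieldSolution {d : ℕ} (γ σ H : ℝ) (A : Space d → Space d)
    (B : Space d → Space d → Space d) (μ : ℝ → Measure (Phase d)) : Prop :=
  IsContinuousCurve μ ∧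
    ∃ (Ω : Type u) (_ : MeasurableSpace Ω) (P : Measure Ω) (_ : IsProbabilityMeasure P)
      (W : ℝ≥0 → Ω → Space d) (X V : ℝ → Ω → Space d),
      IsSolutionProcess P γ σ H A B μ W X V ∧
        ∀ t, 0 ≤ t → P.map (fun ω => (X t ω, V t ω)) = μ t

/-! ### The decay rate -/

/-- The (principal branch of the) Lambert function: for `z ≥ -1/e`, the number `w ≥ -1`
with `w e^w = z`. -/
def lambertW (z : ℝ) : ℝ := Function.invFunOn (fun w => w * Real.exp w) (Ici (-1)) z

theorem lambertW_spec {z : ℝ} (hz : -Real.exp (-1) ≤ z) :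
    -1 ≤ lambertW z ∧ lambertW z * Real.exp (lambertW z) = z := by
  have hmem : z ∈ (fun w => w * Real.exp w) '' Ici (-1 : ℝ) := by
    have hc : ContinuousOn (fun w : ℝ => w * Real.exp w) (Icc (-1) (max z 0)) := by fun_prop
    have h0 : (-1 : ℝ) ≤ max z 0 := le_trans (by norm_num) (le_max_right _ _)
    obtain ⟨w, hw, hw'⟩ := intermediate_value_Icc h0 hc
      (show z ∈ Icc ((-1 : ℝ) * Real.exp (-1)) (max z 0 * Real.exp (max z 0)) from
        ⟨by linarith, (le_max_left z 0).trans
          (le_mul_of_one_le_right (le_max_right _ _) (Real.one_le_exp (le_max_right _ _)))⟩)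
    exact ⟨w, hw.1, hw'⟩
  exact ⟨Function.invFunOn_mem hmem, Function.invFunOn_eq hmem⟩

/-- `λ₁ = γ - (1 + 2γ/(4+γ²)) η - (γ/(4+γ²)) √(4η² + (4+γ²)(γ-η)²)`. -/
def lambdaOne (γ η : ℝ) : ℝ :=
  γ - (1 + 2 * γ / (4 + γ ^ 2)) * η
    - γ / (4 + γ ^ 2) * √(4 * η ^ 2 + (4 + γ ^ 2) * (γ - η) ^ 2)

/-- `λ₂ = ((2+γ)² / ((1+γ)(4+γ²))) η/2`. -/
def lambdaTwo (γ η : ℝ) : ℝ :=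
  (2 + γ) ^ 2 / ((1 + γ) * (4 + γ ^ 2)) * (η / 2)

/-- `λ = λ₁ - W(λ₂ H e^{λ₁ H}) / H`, read as its limit `λ₁ - λ₂` when `H = 0`. -/
def decayRate (γ η H : ℝ) : ℝ :=
  if H = 0 then lambdaOne γ η - lambdaTwo γ η
  else lambdaOne γ η
    - 1 / H * lambertW (lambdaTwo γ η * H * Real.exp (lambdaOne γ η * H))

end

end DelayVFP

open DelayVFP

/-!
# Exponential contraction for a delayed kinetic mean-field equation

The two solutions are coupled synchronously, that is, they are driven by the same Brownian motion.
The noise is additive, so it cancels in the difference `δ = (x, v)` of the two states, which is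
continuously differentiable with `x' = v`, `v' = -x + G - γ v`. Here `G` is the difference of the
Lipschitz parts of the forces.

For `a = γ + 2/γ` and `b = 2/γ` the cross terms in the derivative of `Q(δ)` cancel, and
`(d/dt) Q(δ) ≤ -λ₁ Q(δ) + K m²` (`drift_quadForm_le`), where `m` bounds the averaged mean
distances `E |x_s|` over the delay window and `K` is such that `K |x|²` contributes at most
`λ₂ Q` (`norm_sq_le_quadForm`, `young_const_mul_le_lambdaTwo`). The rate `λ` solves
`λ = λ₁ - λ₂ e^{λ H}` (`decayRate_spec`). If `M` is the supremum of `e^{λ s} E Q(δ_s)` over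
`s ∈ [0, T]`, then integrating the differential inequality pathwise, with the deterministic
bound `m² ≤ C M e^{-λ (t - H)}`, and taking expectations gives `M ≤ θ E Q(δ_0) + (1 - θ) M` with
`θ > 0`. This yields the claimed decay (`IsSynchronous.integral_le`).

The two given solutions live on different probability spaces, and the coupling has to be
constructed (`exists_synchronous`). For frozen coefficient measures the equation has the form
`z(t) = n(t) + ∫_0^t f(s, z(s)) ds` with `f` Lipschitz in `z`. The map that sends a path `z` to
its noise `n`, sampled along a dense sequence of times, is continuous and injective on a Polish
space of paths, so by the Lusin–Souslin theorem it has a measurable left inverse and a measurable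
range (`exists_measurable_solution_map`). The law of the sampled noise is determined by the law of
the initial state, by independence and by uniqueness of the law of Brownian motion. Hence on the
product of a coupling of the initial states with one Brownian motion, the left inverse produces
solutions with the prescribed laws `μ_t` and `ν_t` (`exists_solution_map`); their existence there is
inherited from the given solutions.
-/

namespace DelayVFP

/-! ### The decay rate and the quadratic form -/

theorem lambdaOne_lt {γ η : ℝ} (hγ : 0 < γ) (hη : 0 ≤ η) (hηγ : η < γ) :
    lambdaOne γ η < γ - η := by
  have hD : 0 < 4 + γ ^ 2 := by positivity
  have hS : 0 < √(4 * η ^ 2 + (4 + γ ^ 2) * (γ - η) ^ 2) := by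
    have : 0 < γ - η := by linarith
    positivity
  have h1 : 0 < γ / (4 + γ ^ 2) * √(4 * η ^ 2 + (4 + γ ^ 2) * (γ - η) ^ 2) := by positivity
  have h2 : 0 ≤ 2 * γ / (4 + γ ^ 2) * η := by positivity
  unfold lambdaOne
  linarith

/-- `λ₁` makes the pencil `N - λ Q` degenerate, where `Q = a x² + 2xy + b y²` with `a = γ + 2/γ`,
`b = 2/γ`, and `N` is the dissipation `2x² + 2y²` reduced by the share of the Lipschitz
perturbation. -/
theorem lambdaOne_discriminant {γ η : ℝ} (hγ : 0 < γ) :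
    (2 * (1 - η * (1 + 1 / γ)) - lambdaOne γ η * (γ + 2 / γ)) *
      (2 * (1 - η / γ) - lambdaOne γ η * (2 / γ)) = lambdaOne γ η ^ 2 := by
  have hD : 0 < 4 + γ ^ 2 := by positivity
  have hS := Real.sq_sqrt (show 0 ≤ 4 * η ^ 2 + (4 + γ ^ 2) * (γ - η) ^ 2 by positivity)
  unfold lambdaOne
  set S := √(4 * η ^ 2 + (4 + γ ^ 2) * (γ - η) ^ 2)
  -- `y` is the larger root of `(4 + γ²) y² - 4 η y - (γ - η)² = 0`, and `λ₁ = γ - η - γ y`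
  obtain ⟨y, hy⟩ : ∃ y, y = (2 * η + S) / (4 + γ ^ 2) := ⟨_, rfl⟩
  have hl : γ - (1 + 2 * γ / (4 + γ ^ 2)) * η - γ / (4 + γ ^ 2) * S = γ - η - γ * y := by
    rw [hy]; field_simp; ring
  have hS' : S = (4 + γ ^ 2) * y - 2 * η := by rw [hy]; field_simp; ring
  have hq : (4 + γ ^ 2) * y ^ 2 - 4 * η * y - (γ - η) ^ 2 = 0 := by
    rw [hS'] at hS
    have : (4 + γ ^ 2) * ((4 + γ ^ 2) * y ^ 2 - 4 * η * y - (γ - η) ^ 2) = 0 := by linarith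
    exact (mul_eq_zero.1 this).resolve_left hD.ne'
  rw [hl]
  field_simp
  linear_combination γ ^ 2 * hq

/-- The dissipation dominates `λ₁ Q`, in terms of the lengths `X`, `Y` of position and velocity. -/
theorem quadratic_pencil_nonneg {γ η : ℝ} (hγ : 0 < γ) (hη : 0 ≤ η) (hηγ : η < γ)
    (X Y : ℝ) :
    lambdaOne γ η * ((γ + 2 / γ) * X ^ 2 + 2 * (X * Y) + 2 / γ * Y ^ 2) ≤
      2 * (1 - η * (1 + 1 / γ)) * X ^ 2 + 2 * (1 - η / γ) * Y ^ 2 := by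
  have hdisc := lambdaOne_discriminant (η := η) hγ
  have hr : 0 < 2 * (1 - η / γ) - lambdaOne γ η * (2 / γ) := by
    have := lambdaOne_lt hγ hη hηγ
    have h2 : 2 * (1 - η / γ) - lambdaOne γ η * (2 / γ) = 2 / γ * (γ - η - lambdaOne γ η) := by
      field_simp
    rw [h2]
    exact mul_pos (by positivity) (by linarith)
  set l := lambdaOne γ η
  set r := 2 * (1 - η / γ) - l * (2 / γ)
  set p := 2 * (1 - η * (1 + 1 / γ)) - l * (γ + 2 / γ)
  -- since `p r = λ₁²`, `r` times the form is the square `(λ₁ X - r Y)²`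
  have key : 0 ≤ p * X ^ 2 - 2 * l * (X * Y) + r * Y ^ 2 := by
    have : 0 ≤ r * (p * X ^ 2 - 2 * l * (X * Y) + r * Y ^ 2) := by
      have h : r * (p * X ^ 2 - 2 * l * (X * Y) + r * Y ^ 2) = (l * X - r * Y) ^ 2 := by
        linear_combination X ^ 2 * hdisc
      rw [h]; positivity
    exact nonneg_of_mul_nonneg_right this hr
  have : p * X ^ 2 - 2 * l * (X * Y) + r * Y ^ 2 = 2 * (1 - η * (1 + 1 / γ)) * X ^ 2 +
    2 * (1 - η / γ) * Y ^ 2 - l * ((γ + 2 / γ) * X ^ 2 + 2 * (X * Y) + 2 / γ * Y ^ 2) := by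
    simp only [p, r]; ring
  linarith

/-- Young's inequality for the work of a force bounded by `(c_g + c_B) X + c_B m`. The weights are
those that produce exactly the coefficients of `λ₁` and `λ₂`: the budget left over by the instantaneous
part is `c_B (2 + b) X² + c_B b Y²`, with `b = 2/γ`. -/
theorem interaction_young {γ cg cB : ℝ} (hγ : 0 < γ) (hcg : 0 ≤ cg) (hcB : 0 ≤ cB)
    (X Y m : ℝ) :
    2 * (X + 2 / γ * Y) * ((cg + cB) * X + cB * m) ≤
      2 * ((cg + 2 * cB) * (1 + 1 / γ)) * X ^ 2 + 2 * ((cg + 2 * cB) / γ) * Y ^ 2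
        + cB * (γ + 2) ^ 2 / (2 * γ * (γ + 1)) * m ^ 2 := by
  have h1 : 0 ≤ 2 / γ * (cg + cB) * (X - Y) ^ 2 := by positivity
  have h2 : 0 ≤ cB * (2 * (γ + 1) / γ) * (X - γ / (2 * (γ + 1)) * m) ^ 2 := by positivity
  have h3 : 0 ≤ 2 / γ * cB * (Y - m) ^ 2 := by positivity
  have : 2 * ((cg + 2 * cB) * (1 + 1 / γ)) * X ^ 2 + 2 * ((cg + 2 * cB) / γ) * Y ^ 2
        + cB * (γ + 2) ^ 2 / (2 * γ * (γ + 1)) * m ^ 2 -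
        2 * (X + 2 / γ * Y) * ((cg + cB) * X + cB * m) =
      2 / γ * (cg + cB) * (X - Y) ^ 2 + cB * (2 * (γ + 1) / γ) * (X - γ / (2 * (γ + 1)) * m) ^ 2
      + 2 / γ * cB * (Y - m) ^ 2 := by
    field_simp
    ring
  linarith

theorem lambdaTwo_nonneg {γ η : ℝ} (hγ : 0 < γ) (hη : 0 ≤ η) : 0 ≤ lambdaTwo γ η := by
  unfold lambdaTwo; positivity

/-- The Lambert function encodes the fixed point equation `λ = λ₁ - λ₂ e^{λ H}`; its solution is
positive as soon as `λ₂ < λ₁`, whatever the delay. -/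
theorem decayRate_spec {γ η H : ℝ} (hγ : 0 < γ) (hη : 0 ≤ η) (hH : 0 ≤ H)
    (hlt : lambdaTwo γ η < lambdaOne γ η) :
    0 < decayRate γ η H ∧
      lambdaOne γ η - decayRate γ η H = lambdaTwo γ η * Real.exp (decayRate γ η H * H) := by
  have h2 := lambdaTwo_nonneg hγ hη
  unfold decayRate
  split_ifs with h0
  · subst h0
    exact ⟨by linarith, by simp⟩
  have hH : 0 < H := lt_of_le_of_ne hH (Ne.symm h0)
  set l1 := lambdaOne γ η
  set l2 := lambdaTwo γ η
  have hz : 0 ≤ l2 * H * Real.exp (l1 * H) := by positivity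
  obtain ⟨hw1, hw2⟩ := lambertW_spec (z := l2 * H * Real.exp (l1 * H))
    (le_trans (by simpa using (Real.exp_pos (-1)).le) hz)
  set w := lambertW (l2 * H * Real.exp (l1 * H))
  have hw : w < l1 * H := by
    by_contra! hcon
    have hl : 0 < l1 * H := mul_pos (by linarith) hH
    have h3 : l1 * H * Real.exp (l1 * H) ≤ w * Real.exp w :=
      mul_le_mul hcon (Real.exp_le_exp.2 hcon) (Real.exp_pos _).le (hl.le.trans hcon)
    rw [hw2] at h3
    have h4 : l2 * H * Real.exp (l1 * H) < l1 * H * Real.exp (l1 * H) := by gcongr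
    linarith
  constructor
  · have : 1 / H * w < l1 := by
      rw [one_div, inv_mul_lt_iff₀ hH]; linarith
    linarith
  · have : (l1 - 1 / H * w) * H = l1 * H - w := by field_simp
    rw [this, Real.exp_sub]
    have he := Real.exp_pos w
    field_simp
    linarith

/-- The smallness condition on `η`: `λ₁ - λ₂` is continuous and positive at `η = 0`. -/
theorem exists_lambdaTwo_lt_lambdaOne {γ : ℝ} (hγ : 0 < γ) :
    ∃ η₀ : ℝ, 0 < η₀ ∧ η₀ ≤ γ ∧
      ∀ η : ℝ, 0 ≤ η → η < η₀ → lambdaTwo γ η < lambdaOne γ η := by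
  have hc : Continuous fun η => lambdaOne γ η - lambdaTwo γ η := by
    unfold lambdaOne lambdaTwo; fun_prop
  have h0 : 0 < lambdaOne γ 0 - lambdaTwo γ 0 := by
    have hs : √(4 + γ ^ 2) ^ 2 = 4 + γ ^ 2 := Real.sq_sqrt (by positivity)
    have hs0 : 0 < √(4 + γ ^ 2) := by positivity
    have hsg : γ < √(4 + γ ^ 2) := by
      apply Real.lt_sqrt_of_sq_lt; linarith
    have : lambdaOne γ 0 - lambdaTwo γ 0 = γ / √(4 + γ ^ 2) * (√(4 + γ ^ 2) - γ) := by
      unfold lambdaOne lambdaTwo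
      have h1 : √(4 * 0 ^ 2 + (4 + γ ^ 2) * (γ - 0) ^ 2) = √(4 + γ ^ 2) * γ := by
        rw [show 4 * 0 ^ 2 + (4 + γ ^ 2) * (γ - 0) ^ 2 = (4 + γ ^ 2) * γ ^ 2 by ring,
          Real.sqrt_mul (by positivity), Real.sqrt_sq hγ.le]
      rw [h1]
      nth_rewrite 2 [← hs]
      field_simp
      ring
    rw [this]
    exact mul_pos (by positivity) (by linarith)
  obtain ⟨ε, hε, hb⟩ := Metric.eventually_nhds_iff.1 (hc.continuousAt.eventually (lt_mem_nhds h0))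
  refine ⟨min ε γ, lt_min hε hγ, min_le_right _ _, fun η h1 h2 => ?_⟩
  have := hb (y := η) (by
    rw [Real.dist_eq, sub_zero, abs_of_nonneg h1]; exact h2.trans_le (min_le_left _ _))
  linarith

/-- The optimal constant is `b / (ab - 1) = 2γ / (4 + γ²)`; it enters `λ₂`. -/
theorem norm_sq_le_quadForm {γ : ℝ} (hγ : 0 < γ) {d : ℕ} (z : Phase d) :
    ‖z.1‖ ^ 2 ≤ 2 * γ / (4 + γ ^ 2) * quadForm (γ + 2 / γ) (2 / γ) z := by
  have hi : -(‖z.1‖ * ‖z.2‖) ≤ inner ℝ z.1 z.2 := (abs_le.1 (abs_real_inner_le_norm _ _)).1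
  have h : 2 * γ / (4 + γ ^ 2) * ((γ + 2 / γ) * ‖z.1‖ ^ 2 - 2 * (‖z.1‖ * ‖z.2‖) +
      2 / γ * ‖z.2‖ ^ 2) - ‖z.1‖ ^ 2 = 4 / (4 + γ ^ 2) * (γ / 2 * ‖z.1‖ - ‖z.2‖) ^ 2 := by
    field_simp; ring
  have h2 : 0 ≤ 4 / (4 + γ ^ 2) * (γ / 2 * ‖z.1‖ - ‖z.2‖) ^ 2 := by positivity
  have h3 : 2 * γ / (4 + γ ^ 2) * ((γ + 2 / γ) * ‖z.1‖ ^ 2 - 2 * (‖z.1‖ * ‖z.2‖) +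
      2 / γ * ‖z.2‖ ^ 2) ≤ 2 * γ / (4 + γ ^ 2) * quadForm (γ + 2 / γ) (2 / γ) z := by
    unfold quadForm
    gcongr
    linarith
  linarith

theorem quadForm_nonneg {γ : ℝ} (hγ : 0 < γ) {d : ℕ} (z : Phase d) :
    0 ≤ quadForm (γ + 2 / γ) (2 / γ) z := by
  have h : 0 ≤ 2 * γ / (4 + γ ^ 2) * quadForm (γ + 2 / γ) (2 / γ) z :=
    (by positivity : 0 ≤ ‖z.1‖ ^ 2).trans (norm_sq_le_quadForm hγ z)
  exact nonneg_of_mul_nonneg_right h (by positivity)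

theorem quadForm_pos {γ : ℝ} (hγ : 0 < γ) {d : ℕ} {z : Phase d} (hz : z ≠ 0) :
    0 < quadForm (γ + 2 / γ) (2 / γ) z := by
  refine lt_of_le_of_ne (quadForm_nonneg hγ z) fun h => hz ?_
  have h1 := norm_sq_le_quadForm hγ z
  rw [← h, mul_zero] at h1
  have h2 : z.1 = 0 := by
    rw [← norm_eq_zero]; exact pow_eq_zero_iff two_ne_zero |>.1 (le_antisymm h1 (by positivity))
  rw [quadForm, h2] at h
  have h3 : ‖z.2‖ ^ 2 = 0 := by
    simpa [hγ.ne'] using h.symm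
  exact Prod.ext h2 (by simpa using h3)

theorem quadForm_le_sqLength {γ : ℝ} (hγ : 0 < γ) {d : ℕ} (z : Phase d) :
    quadForm (γ + 2 / γ) (2 / γ) z ≤ (γ + 2 / γ + 1) * sqLength z := by
  have hi : inner ℝ z.1 z.2 ≤ ‖z.1‖ * ‖z.2‖ := real_inner_le_norm _ _
  unfold quadForm sqLength
  have h1 := sq_nonneg (‖z.1‖ - ‖z.2‖)
  have h2 : 0 ≤ γ * ‖z.2‖ ^ 2 := by positivity
  nlinarith

/-- The left-hand side is the derivative of `Q(x, v)` along `x' = v`, `v' = -x + G - γ v`. The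
choice `a = γ + b`, `b γ = 2` cancels the cross terms `⟨x, v⟩` and leaves `-2|x|² - 2|v|²` plus the
work of `G`. -/
theorem drift_quadForm_le {γ cg cB : ℝ} (hγ : 0 < γ) (hcg : 0 ≤ cg) (hcB : 0 ≤ cB)
    (hηγ : cg + 2 * cB < γ) (hl : 0 ≤ lambdaOne γ (cg + 2 * cB)) {d : ℕ} (x v G : Space d)
    {m : ℝ} (hG : ‖G‖ ≤ (cg + cB) * ‖x‖ + cB * m) :
    2 * (γ + 2 / γ) * inner ℝ x v
        + 2 * (inner ℝ x (-x + G - γ • v) + inner ℝ v v)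
        + 2 * (2 / γ) * inner ℝ v (-x + G - γ • v) ≤
      -(lambdaOne γ (cg + 2 * cB) * quadForm (γ + 2 / γ) (2 / γ) (x, v))
        + cB * (γ + 2) ^ 2 / (2 * γ * (γ + 1)) * m ^ 2 := by
  have hη : 0 ≤ cg + 2 * cB := by positivity
  have h1 := quadratic_pencil_nonneg hγ hη hηγ ‖x‖ ‖v‖
  have h2 := interaction_young hγ hcg hcB ‖x‖ ‖v‖ m
  have hi : inner ℝ x v ≤ ‖x‖ * ‖v‖ := real_inner_le_norm _ _
  have h3 : inner ℝ x G + 2 / γ * inner ℝ v G ≤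
      (‖x‖ + 2 / γ * ‖v‖) * ((cg + cB) * ‖x‖ + cB * m) := by
    calc inner ℝ x G + 2 / γ * inner ℝ v G ≤ ‖x‖ * ‖G‖ + 2 / γ * (‖v‖ * ‖G‖) := by
          gcongr <;> exact real_inner_le_norm _ _
      _ = (‖x‖ + 2 / γ * ‖v‖) * ‖G‖ := by ring
      _ ≤ _ := by gcongr
  have h4 : lambdaOne γ (cg + 2 * cB) * quadForm (γ + 2 / γ) (2 / γ) (x, v) ≤
      lambdaOne γ (cg + 2 * cB) *
        ((γ + 2 / γ) * ‖x‖ ^ 2 + 2 * (‖x‖ * ‖v‖) + 2 / γ * ‖v‖ ^ 2) := by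
    unfold quadForm; gcongr
  have h5 : 2 * (γ + 2 / γ) * inner ℝ x v
        + 2 * (inner ℝ x (-x + G - γ • v) + inner ℝ v v)
        + 2 * (2 / γ) * inner ℝ v (-x + G - γ • v) =
      -2 * ‖x‖ ^ 2 - 2 * ‖v‖ ^ 2 + 2 * (inner ℝ x G + 2 / γ * inner ℝ v G) := by
    simp only [inner_add_right, inner_sub_right, inner_neg_right, inner_smul_right,
      real_inner_self_eq_norm_sq, real_inner_comm x v]
    field_simp
    ring
  rw [h5]
  linarith

/-- `λ₂` is the Young constant of the interaction times the best constant in `|x|² ≤ C Q(x, v)`,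
up to `c_B ≤ η / 2`. -/
theorem young_const_mul_le_lambdaTwo {γ cg cB : ℝ} (hγ : 0 < γ) (hcg : 0 ≤ cg) :
    cB * (γ + 2) ^ 2 / (2 * γ * (γ + 1)) * (2 * γ / (4 + γ ^ 2)) ≤
      lambdaTwo γ (cg + 2 * cB) := by
  have h : lambdaTwo γ (cg + 2 * cB) - cB * (γ + 2) ^ 2 / (2 * γ * (γ + 1)) * (2 * γ / (4 + γ ^ 2))
      = (2 + γ) ^ 2 / ((1 + γ) * (4 + γ ^ 2)) * (cg / 2) := by
    unfold lambdaTwo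
    have : 1 + γ ≠ 0 := by positivity
    have : γ + 1 ≠ 0 := by positivity
    field_simp
    ring
  have : 0 ≤ (2 + γ) ^ 2 / ((1 + γ) * (4 + γ ^ 2)) * (cg / 2) := by positivity
  linarith

/-- Pathwise decay. If the force is bounded by the current distance and by a memory term that is
controlled by `M e^{-λ (t - H)}`, then `e^{λ₁ t} Q - M e^{(λ₁ - λ) t}` is nonincreasing, because
`λ₁ - λ = λ₂ e^{λ H}`. The memory bound is deterministic, so that expectations need to be taken only
after integrating in time. -/
theorem exp_mul_quadForm_le {γ cg cB H T M : ℝ} (hγ : 0 < γ) (hcg : 0 ≤ cg) (hcB : 0 ≤ cB)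
    (hηγ : cg + 2 * cB < γ) (hH : 0 ≤ H)
    (hlt : lambdaTwo γ (cg + 2 * cB) < lambdaOne γ (cg + 2 * cB)) (hT : 0 ≤ T) (hM : 0 ≤ M)
    {d : ℕ} {x v G : ℝ → Space d} (hxc : ContinuousOn x (Icc 0 T)) (hvc : ContinuousOn v (Icc 0 T))
    (hx : ∀ t ∈ Ioo 0 T, HasDerivAt x (v t) t)
    (hv : ∀ t ∈ Ioo 0 T, HasDerivAt v (-x t + G t - γ • v t) t)
    (hG : ∀ t ∈ Ioo 0 T, ‖G t‖ ≤ (cg + cB) * ‖x t‖ + cB *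
      √(2 * γ / (4 + γ ^ 2) * M * Real.exp (-decayRate γ (cg + 2 * cB) H * (t - H)))) :
    Real.exp (lambdaOne γ (cg + 2 * cB) * T) * quadForm (γ + 2 / γ) (2 / γ) (x T, v T) ≤
      quadForm (γ + 2 / γ) (2 / γ) (x 0, v 0) + M *
        (Real.exp ((lambdaOne γ (cg + 2 * cB) - decayRate γ (cg + 2 * cB) H) * T) - 1) := by
  have hη : 0 ≤ cg + 2 * cB := by positivity
  obtain ⟨hl0, hl⟩ := decayRate_spec hγ hη hH hlt
  have h20 := lambdaTwo_nonneg hγ hη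
  have hyoung := young_const_mul_le_lambdaTwo (γ := γ) (cB := cB) hγ hcg
  set l := decayRate γ (cg + 2 * cB) H
  set l1 := lambdaOne γ (cg + 2 * cB)
  set l2 := lambdaTwo γ (cg + 2 * cB)
  set a := γ + 2 / γ
  set b := 2 / γ
  let φ : ℝ → ℝ := fun t => Real.exp (l1 * t) *
    (a * inner ℝ (x t) (x t) + 2 * inner ℝ (x t) (v t) + b * inner ℝ (v t) (v t))
      - M * Real.exp ((l1 - l) * t)
  have hφ : ∀ t, φ t = Real.exp (l1 * t) * quadForm a b (x t, v t)
      - M * Real.exp ((l1 - l) * t) := fun t => by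
    simp only [φ, quadForm, real_inner_self_eq_norm_sq]
  have hanti : AntitoneOn φ (Icc 0 T) := by
    refine antitoneOn_of_hasDerivWithinAt_nonpos (convex_Icc 0 T) (by fun_prop)
      (f' := fun t => (Real.exp (l1 * t) * (l1 * 1)) *
          (a * inner ℝ (x t) (x t) + 2 * inner ℝ (x t) (v t) + b * inner ℝ (v t) (v t))
        + Real.exp (l1 * t) * (a * (inner ℝ (x t) (v t) + inner ℝ (v t) (x t))
          + 2 * (inner ℝ (x t) (-x t + G t - γ • v t) + inner ℝ (v t) (v t))
          + b * (inner ℝ (v t) (-x t + G t - γ • v t) + inner ℝ (-x t + G t - γ • v t) (v t)))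
        - M * (Real.exp ((l1 - l) * t) * ((l1 - l) * 1))) ?_ ?_
    · intro t ht
      rw [interior_Icc] at ht
      have h1 := hx t ht
      have h2 := hv t ht
      exact (((((hasDerivAt_id t).const_mul l1).exp).mul
        ((((h1.inner ℝ h1).const_mul a).add ((h1.inner ℝ h2).const_mul 2)).add
          ((h2.inner ℝ h2).const_mul b))).sub
        ((((hasDerivAt_id t).const_mul (l1 - l)).exp).const_mul M)).hasDerivWithinAt
    · intro t ht
      rw [interior_Icc] at ht
      have h1 := drift_quadForm_le hγ hcg hcB hηγ (h20.trans hlt.le) (x t) (v t) (G t) (hG t ht)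
      rw [Real.sq_sqrt (by positivity)] at h1
      have h3 : Real.exp (l1 * t) * (cB * (γ + 2) ^ 2 / (2 * γ * (γ + 1)) *
          (2 * γ / (4 + γ ^ 2) * M * Real.exp (-l * (t - H)))) ≤
          M * (Real.exp ((l1 - l) * t) * (l1 - l)) := by
        have he : Real.exp (l1 * t) * Real.exp (-l * (t - H)) =
            Real.exp ((l1 - l) * t) * Real.exp (l * H) := by
          rw [← Real.exp_add, ← Real.exp_add]; ring_nf
        calc _ = cB * (γ + 2) ^ 2 / (2 * γ * (γ + 1)) * (2 * γ / (4 + γ ^ 2)) *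
              (M * (Real.exp (l1 * t) * Real.exp (-l * (t - H)))) := by ring
          _ ≤ l2 * (M * (Real.exp (l1 * t) * Real.exp (-l * (t - H)))) := by gcongr
          _ = _ := by rw [he, hl]; ring
      have h2 := mul_le_mul_of_nonneg_left h1 (Real.exp_pos (l1 * t)).le
      simp only [quadForm, ← real_inner_self_eq_norm_sq] at h2
      rw [real_inner_comm (x t) (v t)] at *
      rw [real_inner_comm (-x t + G t - γ • v t) (v t)] at *
      rw [mul_add] at h2
      linarith
  have := hanti (left_mem_Icc.2 hT) (right_mem_Icc.2 hT) hT
  simp only [hφ, mul_zero, Real.exp_zero, one_mul, mul_one] at this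
  linarith

/-! ### Second moments and couplings -/

theorem sqLength_nonneg {d : ℕ} (z : Phase d) : 0 ≤ sqLength z := by
  unfold sqLength; positivity

@[fun_prop]
theorem continuous_sqLength {d : ℕ} : Continuous (sqLength (d := d)) := by
  unfold sqLength; fun_prop

@[fun_prop]
theorem continuous_quadForm (a b : ℝ) {d : ℕ} : Continuous (quadForm a b (d := d)) := by
  unfold quadForm; fun_prop

theorem norm_add_sq_le_two_mul {E : Type*} [SeminormedAddCommGroup E] (x y : E) :
    ‖x + y‖ ^ 2 ≤ 2 * ‖x‖ ^ 2 + 2 * ‖y‖ ^ 2 := by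
  have h := pow_le_pow_left₀ (norm_nonneg _) (norm_add_le x y) 2
  nlinarith [sq_nonneg (‖x‖ - ‖y‖)]

theorem sqLength_add_le {d : ℕ} (z w : Phase d) :
    sqLength (z + w) ≤ 2 * sqLength z + 2 * sqLength w := by
  have h1 := norm_add_sq_le_two_mul z.1 w.1
  have h2 := norm_add_sq_le_two_mul z.2 w.2
  simp only [sqLength, Prod.fst_add, Prod.snd_add]
  linarith

theorem sqLength_sub_le {d : ℕ} (z w : Phase d) :
    sqLength (z - w) ≤ 2 * sqLength z + 2 * sqLength w := by
  have h := sqLength_add_le z (-w)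
  simpa [sqLength, sub_eq_add_neg] using h

section RandomStates

variable {d : ℕ} {Ω : Type*} [MeasurableSpace Ω] {P : Measure Ω} {Z Z' : Ω → Phase d}
  {μ ν : Measure (Phase d)}

theorem MemP2.integrable_comp (hμ : MemP2 μ) (hZ : Measurable Z) (hl : P.map Z = μ) :
    Integrable (fun ω => sqLength (Z ω)) P := by
  have h := hμ.2
  rw [← hl] at h
  exact (integrable_map_measure (by fun_prop) hZ.aemeasurable).1 h

theorem MemP2.integral_comp (hZ : Measurable Z) (hl : P.map Z = μ) :
    ∫ ω, sqLength (Z ω) ∂P = ∫ z, sqLength z ∂μ := by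
  rw [← hl, integral_map hZ.aemeasurable (by fun_prop)]

theorem MemP2.integrable_sub (hμ : MemP2 μ) (hν : MemP2 ν) (hZ : Measurable Z)
    (hZ' : Measurable Z') (hl : P.map Z = μ) (hl' : P.map Z' = ν) :
    Integrable (fun ω => sqLength (Z ω - Z' ω)) P := by
  refine (((hμ.integrable_comp hZ hl).const_mul 2).add
    ((hν.integrable_comp hZ' hl').const_mul 2)).mono' ?_ (ae_of_all _ fun ω => ?_)
  · exact (continuous_sqLength.measurable.comp (hZ.sub hZ')).aestronglyMeasurable
  · rw [Real.norm_eq_abs, abs_of_nonneg (sqLength_nonneg _)]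
    exact sqLength_sub_le _ _

theorem MemP2.integral_sub_le (hμ : MemP2 μ) (hν : MemP2 ν) (hZ : Measurable Z)
    (hZ' : Measurable Z') (hl : P.map Z = μ) (hl' : P.map Z' = ν) :
    ∫ ω, sqLength (Z ω - Z' ω) ∂P ≤ 2 * ∫ z, sqLength z ∂μ + 2 * ∫ z, sqLength z ∂ν := by
  rw [← MemP2.integral_comp hZ hl, ← MemP2.integral_comp hZ' hl', ← integral_const_mul,
    ← integral_const_mul, ← MeasureTheory.integral_add
    ((hμ.integrable_comp hZ hl).const_mul 2) ((hν.integrable_comp hZ' hl').const_mul 2)]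
  exact integral_mono (hμ.integrable_sub hν hZ hZ' hl hl')
    (((hμ.integrable_comp hZ hl).const_mul 2).add ((hν.integrable_comp hZ' hl').const_mul 2))
    fun ω => sqLength_sub_le _ _

/-- Jensen's inequality `E f ≤ √(E f²)`, with integrability. -/
theorem integral_le_sqrt_of_sq [IsProbabilityMeasure P] {f : Ω → ℝ} {R : ℝ}
    (hf : AEStronglyMeasurable f P) (hfi : Integrable (fun ω => f ω ^ 2) P)
    (hR : ∫ ω, f ω ^ 2 ∂P ≤ R) : Integrable f P ∧ ∫ ω, f ω ∂P ≤ √R := by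
  have hL : MemLp f 2 P := (memLp_two_iff_integrable_sq hf).2 hfi
  have hi : Integrable f P := hL.integrable (by norm_num)
  refine ⟨hi, Real.le_sqrt_of_sq_le ((?_ : _ ≤ ∫ ω, f ω ^ 2 ∂P).trans hR)⟩
  have hv := variance_nonneg f P
  rw [variance_eq_sub hL] at hv
  simp only [Pi.pow_apply] at hv
  linarith

theorem MemP2.integrable_lipschitz (hμ : MemP2 μ) {c : ℝ} {ψ : Space d → Space d}
    (hψc : Continuous ψ) (hψ : ∀ y y', ‖ψ y - ψ y'‖ ≤ c * ‖y - y'‖) (hZ : Measurable Z)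
    (hl : P.map Z = μ) : Integrable (fun ω => ψ (Z ω).1) P := by
  have hP : IsProbabilityMeasure P := by
    have := hμ.1
    rw [← hl] at this
    exact Measure.isProbabilityMeasure_of_map Z
  have hsq : Integrable (fun ω => ‖(Z ω).1‖ ^ 2) P := by
    refine (hμ.integrable_comp hZ hl).mono' (by fun_prop) (ae_of_all _ fun ω => ?_)
    rw [Real.norm_eq_abs, abs_of_nonneg (by positivity)]
    unfold sqLength
    have : 0 ≤ ‖(Z ω).2‖ ^ 2 := by positivity
    linarith
  have hn := (integral_le_sqrt_of_sq (P := P) (f := fun ω => ‖(Z ω).1‖) (by fun_prop)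
    hsq le_rfl).1
  refine ((hn.const_mul c).add (integrable_const ‖ψ 0‖)).mono'
    (hψc.measurable.comp hZ.fst).aestronglyMeasurable (ae_of_all _ fun ω => ?_)
  have h1 := hψ (Z ω).1 0
  rw [sub_zero] at h1
  have h2 := norm_add_le (ψ (Z ω).1 - ψ 0) (ψ 0)
  rw [sub_add_cancel] at h2
  simp only [Pi.add_apply]
  linarith

/-- Averages of two Lipschitz functions against two laws are compared through a coupling. -/
theorem norm_integral_fst_sub_le [IsProbabilityMeasure P] (hμ : MemP2 μ) (hν : MemP2 ν)
    (hZ : Measurable Z) (hZ' : Measurable Z') (hl : P.map Z = μ) (hl' : P.map Z' = ν)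
    {r c R : ℝ} (hc : 0 ≤ c) {ψ ψ' : Space d → Space d} (hψc : Continuous ψ)
    (hψc' : Continuous ψ')
    (hψ : ∀ y y', ‖ψ y - ψ y'‖ ≤ c * ‖y - y'‖) (hψ' : ∀ y y', ‖ψ' y - ψ' y'‖ ≤ c * ‖y - y'‖)
    (h : ∀ y y', ‖ψ y - ψ' y'‖ ≤ r + c * ‖y - y'‖)
    (hR : ∫ ω, ‖(Z ω).1 - (Z' ω).1‖ ^ 2 ∂P ≤ R) :
    ‖∫ y, ψ y ∂μ.fst - ∫ y, ψ' y ∂ν.fst‖ ≤ r + c * √R := by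
  have e1 : ∫ y, ψ y ∂μ.fst = ∫ ω, ψ (Z ω).1 ∂P := by
    rw [← hl, Measure.fst, Measure.map_map measurable_fst hZ, integral_map
      (measurable_fst.comp hZ).aemeasurable hψc.aestronglyMeasurable]
    rfl
  have e2 : ∫ y, ψ' y ∂ν.fst = ∫ ω, ψ' (Z' ω).1 ∂P := by
    rw [← hl', Measure.fst, Measure.map_map measurable_fst hZ', integral_map
      (measurable_fst.comp hZ').aemeasurable hψc'.aestronglyMeasurable]
    rfl
  have hsq : Integrable (fun ω => ‖(Z ω).1 - (Z' ω).1‖ ^ 2) P := by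
    refine (hμ.integrable_sub hν hZ hZ' hl hl').mono' (by fun_prop) (ae_of_all _ fun ω => ?_)
    rw [Real.norm_eq_abs, abs_of_nonneg (by positivity)]
    simp only [sqLength, Prod.fst_sub, Prod.snd_sub]
    have : 0 ≤ ‖(Z ω).2 - (Z' ω).2‖ ^ 2 := by positivity
    linarith
  obtain ⟨hi, hle⟩ := integral_le_sqrt_of_sq (P := P) (f := fun ω => ‖(Z ω).1 - (Z' ω).1‖)
    (by fun_prop) hsq hR
  rw [e1, e2, ← MeasureTheory.integral_sub (hμ.integrable_lipschitz hψc hψ hZ hl)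
    (hν.integrable_lipschitz hψc' hψ' hZ' hl')]
  calc _ ≤ ∫ ω, (r + c * ‖(Z ω).1 - (Z' ω).1‖) ∂P :=
        norm_integral_le_of_norm_le ((integrable_const r).add (hi.const_mul c))
          (ae_of_all _ fun ω => h _ _)
    _ = r + c * ∫ ω, ‖(Z ω).1 - (Z' ω).1‖ ∂P := by
        rw [MeasureTheory.integral_add (integrable_const r) (hi.const_mul c), integral_const_mul]
        simp
    _ ≤ _ := by gcongr

end RandomStates

section Curves

variable {d : ℕ} {μ : ℝ → Measure (Phase d)}

theorem transportDist_sq (c : Phase d → ℝ) (μ ν : Measure (Phase d)) :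
    transportDist c μ ν ^ 2 =
      ⨅ π ∈ couplings μ ν, ∫⁻ p, ENNReal.ofReal (c (p.1 - p.2)) ∂π := by
  rw [transportDist, ← ENNReal.rpow_natCast, ← ENNReal.rpow_mul]
  norm_num

theorem exists_coupling_of_distTwo_lt {μ ν : Measure (Phase d)} (hμ : MemP2 μ)
    {ε : ℝ} (hε : 0 < ε) (h : distTwo μ ν < ENNReal.ofReal ε) :
    ∃ π : Measure (Phase d × Phase d), IsProbabilityMeasure π ∧ π.map Prod.fst = μ ∧
      π.map Prod.snd = ν ∧ ∫ p, sqLength (p.1 - p.2) ∂π ≤ ε ^ 2 := by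
  have h2 : distTwo μ ν ^ 2 < ENNReal.ofReal ε ^ 2 := ENNReal.pow_lt_pow_left two_ne_zero h
  rw [distTwo, transportDist_sq] at h2
  simp only [iInf_lt_iff] at h2
  obtain ⟨π, ⟨h3, h4⟩, h5⟩ := h2
  refine ⟨π, ?_, h3, h4, ?_⟩
  · have := hμ.1
    rw [← h3] at this
    exact Measure.isProbabilityMeasure_of_map Prod.fst
  · rw [integral_eq_lintegral_of_nonneg_ae (ae_of_all _ fun _ => sqLength_nonneg _)
      (by fun_prop)]
    refine ENNReal.toReal_le_of_le_ofReal (by positivity) ?_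
    rw [ENNReal.ofReal_pow hε.le]
    exact h5.le

theorem IsContinuousCurve.eventually_exists_coupling (hμ : IsContinuousCurve μ) {t : ℝ}
    (ht : 0 ≤ t) {ε : ℝ} (hε : 0 < ε) :
    ∀ᶠ s in 𝓝[Ici 0] t, ∃ π : Measure (Phase d × Phase d), IsProbabilityMeasure π ∧
      π.map Prod.fst = μ s ∧ π.map Prod.snd = μ t ∧ ∫ p, sqLength (p.1 - p.2) ∂π ≤ ε ^ 2 := by
  have h := (hμ.2 t ht).eventually (gt_mem_nhds (ENNReal.ofReal_pos.2 hε))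
  filter_upwards [h, self_mem_nhdsWithin] with s hs hs0
  exact exists_coupling_of_distTwo_lt (hμ.1 s hs0) hε hs

/-- Lipschitz functions of the position have averages that are continuous in time: close laws have
a coupling with small mean square distance. -/
theorem IsContinuousCurve.continuousOn_integral_fst (hμ : IsContinuousCurve μ) {c : ℝ}
    (hc : 0 ≤ c) {ψ : Space d → Space d} (hψc : Continuous ψ)
    (hψ : ∀ y y', ‖ψ y - ψ y'‖ ≤ c * ‖y - y'‖) :
    ContinuousOn (fun s => ∫ y, ψ y ∂(μ s).fst) (Ici 0) := by
  intro t ht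
  refine Metric.tendsto_nhds.2 fun ε hε => ?_
  filter_upwards [hμ.eventually_exists_coupling ht (ε := ε / (c + 1)) (by positivity),
    self_mem_nhdsWithin] with s ⟨π, hπ, h1, h2, h3⟩ hs
  have hle : ∫ p : Phase d × Phase d, ‖p.1.1 - p.2.1‖ ^ 2 ∂π ≤ (ε / (c + 1)) ^ 2 := by
    refine le_trans (integral_mono_of_nonneg (ae_of_all _ fun p => by positivity)
      ((hμ.1 s hs).integrable_sub (hμ.1 t ht) measurable_fst measurable_snd h1 h2)
      (ae_of_all _ fun p => ?_)) h3
    simp only [sqLength, Prod.fst_sub, Prod.snd_sub]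
    have : 0 ≤ ‖p.1.2 - p.2.2‖ ^ 2 := by positivity
    linarith
  have := norm_integral_fst_sub_le (r := 0) (hμ.1 s hs) (hμ.1 t ht) measurable_fst measurable_snd
    h1 h2 hc hψc hψc hψ hψ (by simpa using hψ) hle
  rw [Real.sqrt_sq (by positivity), zero_add] at this
  rw [dist_eq_norm]
  refine this.trans_lt ?_
  rw [← mul_div_assoc, div_lt_iff₀ (by positivity)]
  linarith

theorem IsContinuousCurve.exists_second_moment_bound (hμ : IsContinuousCurve μ) (T : ℝ) :
    ∃ C : ℝ, ∀ s ∈ Icc 0 T, ∫ z, sqLength z ∂(μ s) ≤ C := by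
  refine isCompact_Icc.induction_on (p := fun S => ∃ C : ℝ, ∀ s ∈ S, ∫ z, sqLength z ∂(μ s) ≤ C)
    ⟨0, by simp⟩ (fun S S' h ⟨C, hC⟩ => ⟨C, fun s hs => hC s (h hs)⟩)
    (fun S S' ⟨C, hC⟩ ⟨C', hC'⟩ => ⟨max C C', fun s hs => ?_⟩) fun t ht => ?_
  · rcases hs with hs | hs
    · exact (hC s hs).trans (le_max_left _ _)
    · exact (hC' s hs).trans (le_max_right _ _)
  · have h := (hμ.eventually_exists_coupling ht.1 one_pos).filter_mono
      (nhdsWithin_mono t Icc_subset_Ici_self : 𝓝[Icc 0 T] t ≤ _)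
    refine ⟨_, h.and self_mem_nhdsWithin, 2 * ∫ z, sqLength z ∂(μ t) + 2, ?_⟩
    rintro s ⟨⟨π, hπ, h1, h2, h3⟩, hs⟩
    have hs := hμ.1 s hs.1
    have ht := hμ.1 t ht.1
    have hi1 := hs.integrable_comp measurable_fst h1
    have hi2 := ht.integrable_comp measurable_snd h2
    have hi3 := hs.integrable_sub ht measurable_fst measurable_snd h1 h2
    rw [← MemP2.integral_comp measurable_fst h1, ← MemP2.integral_comp measurable_snd h2]
    calc _ ≤ ∫ p, (2 * sqLength p.2 + 2 * sqLength (p.1 - p.2)) ∂π := by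
          refine integral_mono hi1 ((hi2.const_mul 2).add (hi3.const_mul 2)) fun p => ?_
          simpa using sqLength_add_le p.2 (p.1 - p.2)
      _ = 2 * ∫ p, sqLength p.2 ∂π + 2 * ∫ p, sqLength (p.1 - p.2) ∂π := by
          rw [MeasureTheory.integral_add (hi2.const_mul 2) (hi3.const_mul 2),
            integral_const_mul, integral_const_mul]
      _ ≤ _ := by linarith

end Curves

/-! ### The interaction force -/

section Force

variable {d : ℕ} {cg cB α : ℝ} {A : Space d → Space d} {B : Space d → Space d → Space d}

theorem CoefficientAssumption.interaction_sub_le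
    (h : CoefficientAssumption α cg cB A B) (x x' y y' : Space d) :
    ‖B x y - B x' y'‖ ≤ cB * ‖x - x'‖ + cB * ‖y - y'‖ := by
  have h1 := h.interaction x x' y y
  have h2 := h.interaction x' x' y y'
  have h3 := norm_sub_le_norm_sub_add_norm_sub (B x y) (B x' y) (B x' y')
  simp only [sub_self, norm_zero] at h1 h2
  linarith

theorem CoefficientAssumption.interaction_right
    (h : CoefficientAssumption α cg cB A B) (x y y' : Space d) :
    ‖B x y - B x y'‖ ≤ cB * ‖y - y'‖ := by
  simpa using h.interaction_sub_le x x y y'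

theorem continuous_of_norm_sub_le {E F : Type*} [SeminormedAddCommGroup E]
    [SeminormedAddCommGroup F] {f : E → F} {c : ℝ} (hc : 0 ≤ c)
    (h : ∀ x y, ‖f x - f y‖ ≤ c * ‖x - y‖) : Continuous f :=
  (LipschitzWith.of_dist_le_mul (K := ⟨c, hc⟩) fun x y => by
    rw [dist_eq_norm, dist_eq_norm]; exact h x y).continuous

/-- The interaction force, with the time average written over the unit interval. This is
continuous in time, with no case distinction at `h(t) = 0`; times are cut off at `0` so that it
is defined on all of `ℝ`. -/
noncomputable def avgForce (H : ℝ) (B : Space d → Space d → Space d)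
    (μ : ℝ → Measure (Phase d)) (t : ℝ) (x : Space d) : Space d :=
  ∫ u in (0 : ℝ)..1, ∫ y, B x y ∂(μ (max (t - cutoff H t * u) 0)).fst

theorem interactionForce_eq_avgForce {H t : ℝ} (μ : ℝ → Measure (Phase d)) (ht : 0 ≤ t)
    (x : Space d) : interactionForce H B μ t x = avgForce H B μ t x := by
  have hle : cutoff H t ≤ t := min_le_left _ _
  have hmax : ∀ u ∈ uIcc (0 : ℝ) 1, max (t - cutoff H t * u) 0 = t - cutoff H t * u := by
    intro u hu
    rw [uIcc_of_le zero_le_one] at hu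
    refine max_eq_left ?_
    rcases le_or_gt (cutoff H t) 0 with h0 | h0
    · nlinarith [hu.1]
    · nlinarith [hu.2]
  have hc : avgForce H B μ t x =
      ∫ u in (0 : ℝ)..1, ∫ y, B x y ∂(μ (t - cutoff H t * u)).fst :=
    intervalIntegral.integral_congr fun u hu => by simp only [hmax u hu]
  rw [hc, interactionForce, delayAverage]
  split_ifs with h0
  · simp [h0]
  · rw [intervalIntegral.integral_comp_sub_mul (fun s => ∫ y, B x y ∂(μ s).fst) h0]
    simp

variable {H γ : ℝ} {μ ν : ℝ → Measure (Phase d)}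

theorem continuous_integral_delayed (h : CoefficientAssumption α cg cB A B) (hcB : 0 ≤ cB)
    (hμ : IsContinuousCurve μ) (x : Space d) :
    Continuous fun p : ℝ × ℝ => ∫ y, B x y ∂(μ (max (p.1 - cutoff H p.1 * p.2) 0)).fst := by
  have hψ := h.interaction_right x
  have hs := hμ.continuousOn_integral_fst hcB (continuous_of_norm_sub_le hcB hψ) hψ
  refine hs.comp_continuous (f := fun p : ℝ × ℝ => max (p.1 - cutoff H p.1 * p.2) 0) ?_
    fun p => mem_Ici.2 (le_max_right _ _)
  unfold cutoff
  fun_prop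

theorem continuous_avgForce (h : CoefficientAssumption α cg cB A B) (hcB : 0 ≤ cB)
    (hμ : IsContinuousCurve μ) (x : Space d) : Continuous fun t => avgForce H B μ t x :=
  intervalIntegral.continuous_parametric_intervalIntegral_of_continuous'
    (continuous_integral_delayed h hcB hμ x) 0 1

theorem norm_avgForce_sub_le (h : CoefficientAssumption α cg cB A B) (hcB : 0 ≤ cB)
    (hμ : IsContinuousCurve μ) (hν : IsContinuousCurve ν) {t C : ℝ} (x x' : Space d)
    (hC : ∀ u ∈ Icc (0 : ℝ) 1,
      ‖∫ y, B x y ∂(μ (max (t - cutoff H t * u) 0)).fst -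
        ∫ y, B x' y ∂(ν (max (t - cutoff H t * u) 0)).fst‖ ≤ C) :
    ‖avgForce H B μ t x - avgForce H B ν t x'‖ ≤ C := by
  have hi : ∀ {ρ : ℝ → Measure (Phase d)}, IsContinuousCurve ρ → ∀ z : Space d,
      IntervalIntegrable (fun u => ∫ y, B z y ∂(ρ (max (t - cutoff H t * u) 0)).fst)
        volume 0 1 := fun hρ z =>
    ((continuous_integral_delayed (H := H) h hcB hρ z).comp
      (Continuous.prodMk_right t)).intervalIntegrable 0 1
  rw [avgForce, avgForce, ← intervalIntegral.integral_sub (hi hμ x) (hi hν x')]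
  have := intervalIntegral.norm_integral_le_of_norm_le_const (a := 0) (b := 1) (C := C)
    (f := fun u => ∫ y, B x y ∂(μ (max (t - cutoff H t * u) 0)).fst -
        ∫ y, B x' y ∂(ν (max (t - cutoff H t * u) 0)).fst) fun u hu => by
      rw [uIoc_of_le zero_le_one] at hu
      exact hC u (Ioc_subset_Icc_self hu)
  simpa using this

theorem norm_avgForce_sub_le_self (h : CoefficientAssumption α cg cB A B) (hcB : 0 ≤ cB)
    (hμ : IsContinuousCurve μ) (t : ℝ) (x x' : Space d) :
    ‖avgForce H B μ t x - avgForce H B μ t x'‖ ≤ cB * ‖x - x'‖ := by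
  refine norm_avgForce_sub_le h hcB hμ hμ x x' fun u _ => ?_
  have hs := hμ.1 (max (t - cutoff H t * u) 0) (le_max_right _ _)
  have := hs.1
  have hc := fun z => continuous_of_norm_sub_le hcB (h.interaction_right z)
  simpa using norm_integral_fst_sub_le (P := μ (max (t - cutoff H t * u) 0)) hs hs measurable_id
    measurable_id Measure.map_id Measure.map_id hcB (hc x) (hc x') (h.interaction_right x)
    (h.interaction_right x') (h.interaction_sub_le x x') (R := 0) (by simp)

/-- The drift of the phase space equation with frozen coefficient measures `μ`. -/
noncomputable def drift (γ H : ℝ) (A : Space d → Space d) (B : Space d → Space d → Space d)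
    (μ : ℝ → Measure (Phase d)) (t : ℝ) (z : Phase d) : Phase d :=
  (z.2, A z.1 + avgForce H B μ t z.1 - γ • z.2)

theorem CoefficientAssumption.norm_force_sub_le
    (h : CoefficientAssumption 1 cg cB A B) (x y : Space d) :
    ‖(A x - A y) + (x - y)‖ ≤ cg * ‖x - y‖ := by
  obtain ⟨g, hA, hg⟩ := h.force
  convert hg x y using 2
  rw [hA, hA, one_smul, one_smul]
  abel

theorem continuous_drift (h : CoefficientAssumption 1 cg cB A B) (hcB : 0 ≤ cB)
    (hμ : IsContinuousCurve μ) (z : Phase d) : Continuous fun t => drift γ H A B μ t z := by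
  have := continuous_avgForce (H := H) h hcB hμ z.1
  unfold drift
  fun_prop

theorem exists_lipschitzWith_drift (h : CoefficientAssumption 1 cg cB A B) (hγ : 0 < γ)
    (hcg : 0 ≤ cg) (hcB : 0 ≤ cB) (hμ : IsContinuousCurve μ) :
    ∃ K : ℝ≥0, ∀ t, LipschitzWith K (drift γ H A B μ t) := by
  refine ⟨⟨1 + cg + cB + γ, by positivity⟩, fun t => LipschitzWith.of_dist_le_mul fun z w => ?_⟩
  rw [dist_eq_norm, dist_eq_norm]
  have h1 : ‖z.1 - w.1‖ ≤ ‖z - w‖ := norm_fst_le (z - w)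
  have h2 : ‖z.2 - w.2‖ ≤ ‖z - w‖ := norm_snd_le (z - w)
  have h3 := h.norm_force_sub_le z.1 w.1
  have h4 := norm_avgForce_sub_le_self (H := H) h hcB hμ t z.1 w.1
  have h0 := norm_nonneg (z - w)
  change _ ≤ (1 + cg + cB + γ) * ‖z - w‖
  refine max_le ?_ ?_
  · change ‖z.2 - w.2‖ ≤ _
    have : 0 ≤ (cg + cB + γ) * ‖z - w‖ := by positivity
    linarith
  · change ‖(A z.1 + avgForce H B μ t z.1 - γ • z.2) - (A w.1 + avgForce H B μ t w.1 - γ • w.2)‖ ≤ _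
    have e : (A z.1 + avgForce H B μ t z.1 - γ • z.2) - (A w.1 + avgForce H B μ t w.1 - γ • w.2) =
        ((A z.1 - A w.1) + (z.1 - w.1)) - (z.1 - w.1)
          + (avgForce H B μ t z.1 - avgForce H B μ t w.1) - γ • (z.2 - w.2) := by
      rw [smul_sub]; abel
    rw [e]
    refine (norm_sub_le _ _).trans ?_
    rw [norm_smul, Real.norm_of_nonneg hγ.le]
    have h5 := norm_add_le (((A z.1 - A w.1) + (z.1 - w.1)) - (z.1 - w.1))
      (avgForce H B μ t z.1 - avgForce H B μ t w.1)
    have h6 := norm_sub_le ((A z.1 - A w.1) + (z.1 - w.1)) (z.1 - w.1)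
    have h7 := mul_le_mul_of_nonneg_left h1 hcg
    have h8 := mul_le_mul_of_nonneg_left h1 hcB
    have h9 := mul_le_mul_of_nonneg_left h2 hγ.le
    linarith

end Force

/-! ### Additive-noise equations as Volterra equations -/

section Volterra

section Paths

variable {E : Type*} [NormedAddCommGroup E] {T : ℝ} {f : ℝ → E → E} {K : ℝ≥0}

theorem continuous_comp_path (hT : 0 ≤ T) (hfc : ∀ x, Continuous fun t => f t x)
    (hf : ∀ t, LipschitzWith K (f t)) (z : C(Icc (0 : ℝ) T, E)) :
    Continuous fun t => f t (IccExtend hT z t) := by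
  have h : Continuous (Function.uncurry f) :=
    continuous_prod_of_continuous_lipschitzWith' _ K hf hfc
  have hz : Continuous (IccExtend hT z) := z.continuous.Icc_extend'
  exact h.comp (continuous_id.prodMk hz)

theorem norm_IccExtend_sub_le (hT : 0 ≤ T) (z w : C(Icc (0 : ℝ) T, E)) (t : ℝ) :
    ‖IccExtend hT z t - IccExtend hT w t‖ ≤ ‖z - w‖ :=
  (z - w).norm_coe_le_norm (projIcc 0 T hT t)

end Paths

variable {E : Type*} [NormedAddCommGroup E] [NormedSpace ℝ E] {T : ℝ}

/-- The noise needed to make the path `z` on `[0, T]` a solution of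
`z(t) = n(t) + ∫_0^t f(s, z(s)) ds`. -/
noncomputable def volterraNoise (hT : 0 ≤ T) (f : ℝ → E → E) (z : C(Icc (0 : ℝ) T, E))
    (t : ℝ) : E :=
  IccExtend hT z t - ∫ s in (0 : ℝ)..t, f s (IccExtend hT z s)

variable {f : ℝ → E → E} {K : ℝ≥0}

theorem continuous_volterraNoise_path (hT : 0 ≤ T) (hfc : ∀ x, Continuous fun t => f t x)
    (hf : ∀ t, LipschitzWith K (f t)) (z : C(Icc (0 : ℝ) T, E)) :
    Continuous (volterraNoise hT f z) := by
  have hz : Continuous (IccExtend hT z) := z.continuous.Icc_extend'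
  exact hz.sub (intervalIntegral.continuous_primitive
    (fun a b => (continuous_comp_path hT hfc hf z).intervalIntegrable a b) 0)

theorem continuous_volterraNoise (hT : 0 ≤ T) (hfc : ∀ x, Continuous fun t => f t x)
    (hf : ∀ t, LipschitzWith K (f t)) (t : Icc (0 : ℝ) T) :
    Continuous fun z : C(Icc (0 : ℝ) T, E) => volterraNoise hT f z t := by
  refine continuous_of_norm_sub_le (c := 1 + K * T) (by positivity) fun z w => ?_
  have hi := fun y => (continuous_comp_path hT hfc hf y).intervalIntegrable (μ := volume) 0 t
  have e : volterraNoise hT f z t - volterraNoise hT f w t =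
      (IccExtend hT z t - IccExtend hT w t) -
        ∫ s in (0 : ℝ)..t, (f s (IccExtend hT z s) - f s (IccExtend hT w s)) := by
    rw [intervalIntegral.integral_sub (hi z) (hi w), volterraNoise, volterraNoise]
    abel
  rw [e]
  have h1 := norm_IccExtend_sub_le hT z w t
  have h2 := intervalIntegral.norm_integral_le_of_norm_le_const (a := 0) (b := t)
    (C := K * ‖z - w‖) (f := fun s => f s (IccExtend hT z s) - f s (IccExtend hT w s))
    fun s _ => ((hf s).norm_sub_le _ _).trans (by
      gcongr; exact norm_IccExtend_sub_le hT z w s)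
  rw [sub_zero, abs_of_nonneg t.2.1] at h2
  have h3 : K * ‖z - w‖ * t ≤ K * ‖z - w‖ * T := by gcongr; exact t.2.2
  have h4 := norm_sub_le (IccExtend hT z t - IccExtend hT w t)
    (∫ s in (0 : ℝ)..t, (f s (IccExtend hT z s) - f s (IccExtend hT w s)))
  linarith

/-- Pathwise uniqueness: two paths with the same noise agree, by Grönwall's inequality. -/
theorem eq_of_volterraNoise_eq [CompleteSpace E] (hT : 0 ≤ T)
    (hfc : ∀ x, Continuous fun t => f t x)
    (hf : ∀ t, LipschitzWith K (f t)) {z w : C(Icc (0 : ℝ) T, E)}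
    (h : ∀ t ∈ Icc (0 : ℝ) T, volterraNoise hT f z t = volterraNoise hT f w t) : z = w := by
  let g : ℝ → E := fun s => f s (IccExtend hT z s) - f s (IccExtend hT w s)
  have hi := fun y (t : ℝ) =>
    (continuous_comp_path hT hfc hf y).intervalIntegrable (μ := volume) 0 t
  have hg : Continuous g :=
    (continuous_comp_path hT hfc hf z).sub (continuous_comp_path hT hfc hf w)
  let U : ℝ → E := fun t => ∫ s in (0 : ℝ)..t, g s
  have hU : ∀ t, HasDerivAt U (g t) t := fun t => hg.integral_hasStrictDerivAt 0 t |>.hasDerivAt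
  have hzw : ∀ t ∈ Icc (0 : ℝ) T, IccExtend hT z t - IccExtend hT w t = U t := by
    intro t ht
    have h1 := h t ht
    simp only [U, g]
    rw [intervalIntegral.integral_sub (hi z t) (hi w t)]
    rw [volterraNoise, volterraNoise, sub_eq_sub_iff_add_eq_add] at h1
    rw [sub_eq_sub_iff_add_eq_add, h1, add_comm]
  have h0 := eq_zero_of_abs_deriv_le_mul_abs_self_of_eq_zero_right (f := U) (f' := g) (K := K)
    (a := 0) (b := T) (fun t _ => (hU t).continuousAt.continuousWithinAt)
    (fun t _ => (hU t).hasDerivWithinAt) (by simp [U]) fun t ht => by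
      rw [← hzw t (Ico_subset_Icc_self ht)]
      exact (hf t).norm_sub_le _ _
  ext t
  have := (hzw t t.2).trans (h0 t t.2)
  rw [IccExtend_val, IccExtend_val] at this
  exact sub_eq_zero.1 this

/-- The solution map of a Volterra equation, as a measurable function of the noise sampled along a
dense sequence of times. By the Lusin–Souslin theorem the injective continuous
map from paths to sampled noises is a Borel isomorphism onto its range; solvability outside the
range is not claimed. -/
theorem exists_measurable_solution_map [CompleteSpace E] [SecondCountableTopology E]
    [MeasurableSpace E] [BorelSpace E] (hT : 0 ≤ T) (hfc : ∀ x, Continuous fun t => f t x)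
    (hf : ∀ t, LipschitzWith K (f t)) {q : ℕ → Icc (0 : ℝ) T} (hq : DenseRange q) :
    ∃ Ψ : (ℕ → E) → C(Icc (0 : ℝ) T, E), (∀ s, Measurable fun y => Ψ y s) ∧
      (∀ z, Ψ (fun k => volterraNoise hT f z (q k)) = z) ∧
      MeasurableSet (range fun z k => volterraNoise hT f z (q k)) := by
  let _ : MeasurableSpace C(Icc (0 : ℝ) T, E) := borel _
  have _ : BorelSpace C(Icc (0 : ℝ) T, E) := ⟨rfl⟩
  let J : C(Icc (0 : ℝ) T, E) → ℕ → E := fun z k => volterraNoise hT f z (q k)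
  have hJc : Continuous J := continuous_pi fun k => continuous_volterraNoise hT hfc hf (q k)
  have hJi : Function.Injective J := by
    intro z w hzw
    refine eq_of_volterraNoise_eq hT hfc hf fun t ht => ?_
    exact congrFun (Continuous.ext_on hq
      ((continuous_volterraNoise_path hT hfc hf z).comp continuous_subtype_val)
      ((continuous_volterraNoise_path hT hfc hf w).comp continuous_subtype_val)
      (forall_mem_range.2 (congrFun hzw))) ⟨t, ht⟩
  have hJ : MeasurableEmbedding J := hJc.measurableEmbedding hJi
  obtain ⟨Ψ, hΨ, hΨJ⟩ := hJ.exists_measurable_extend measurable_id fun _ => ⟨0⟩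
  exact ⟨Ψ, fun s => (continuous_eval_const s).measurable.comp hΨ,
    fun z => congrFun hΨJ z, hJ.measurableSet_range⟩

end Volterra

/-! ### Uniqueness of the law of Brownian motion -/

section Brownian

variable {d : ℕ} {Ω : Type u} [MeasurableSpace Ω] {P : Measure Ω} {W : ℝ≥0 → Ω → Space d}
  {Ω' : Type v} [MeasurableSpace Ω'] {P' : Measure Ω'} {W' : ℝ≥0 → Ω' → Space d}

theorem IsBrownian.map_coord_eq_pi [IsProbabilityMeasure P] (hW : IsBrownian W P) :
    P.map (fun ω (i : Fin d) (t : ℝ≥0) => W t ω i) =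
      Measure.pi fun i => P.map (fun ω (t : ℝ≥0) => W t ω i) := by
  refine (iIndepFun_iff_map_fun_eq_pi_map fun i => ?_).1 hW.indep
  have := hW.measurable
  exact (measurable_pi_lambda _ fun t => by fun_prop).aemeasurable

/-- Only the law along a sequence of times is compared; this is the countable product on which the
solution map is defined. -/
theorem IsBrownian.map_eq [IsProbabilityMeasure P] [IsProbabilityMeasure P']
    (hW : IsBrownian W P) (hW' : IsBrownian W' P') (q : ℕ → ℝ≥0) :
    P.map (fun ω k => W (q k) ω) = P'.map (fun ω k => W' (q k) ω) := by
  have hm := hW.measurable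
  have hm' := hW'.measurable
  have hc : ∀ i : Fin d, P.map (fun ω (t : ℝ≥0) => W t ω i) =
      P'.map (fun ω (t : ℝ≥0) => W' t ω i) := by
    intro i
    have h1 := (hW.coord i).toIsPreBrownianReal
    have h2 := (hW'.coord i).toIsPreBrownianReal
    have l1 := isProjectiveLimit_map (P := P) (X := fun t ω => W t ω i)
      (measurable_pi_lambda _ fun t => by fun_prop).aemeasurable
    have l2 := isProjectiveLimit_map (P := P') (X := fun t ω => W' t ω i)
      (measurable_pi_lambda _ fun t => by fun_prop).aemeasurable
    simp only [fun I => (h1.hasLaw I).map_eq] at l1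
    simp only [fun I => (h2.hasLaw I).map_eq] at l2
    exact l1.unique l2
  have hcoord : P.map (fun ω (i : Fin d) (t : ℝ≥0) => W t ω i) =
      P'.map (fun ω (i : Fin d) (t : ℝ≥0) => W' t ω i) := by
    rw [hW.map_coord_eq_pi, hW'.map_coord_eq_pi]
    simp only [hc]
  let F : (Fin d → ℝ≥0 → ℝ) → ℕ → Space d := fun p k => WithLp.toLp 2 fun i => p i (q k)
  have hF : Measurable F := by
    refine measurable_pi_lambda _ fun k => (WithLp.measurable_toLp 2 _).comp ?_
    fun_prop
  have h := congrArg (Measure.map F) hcoord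
  rw [Measure.map_map hF (by fun_prop), Measure.map_map hF (by fun_prop)] at h
  exact h

end Brownian

/-! ### Solutions as functionals of the noise -/

section SolutionLaw

variable {d : ℕ} {cg cB γ σ H T : ℝ} {A : Space d → Space d} {B : Space d → Space d → Space d}
  {μ : ℝ → Measure (Phase d)} {Ω : Type u} [MeasurableSpace Ω] {P : Measure Ω}
  {W : ℝ≥0 → Ω → Space d} {X V : ℝ → Ω → Space d}

/-- Almost every path of a solution process solves the Volterra equation whose noise is the initial
state plus the scaled Brownian motion in the velocity component. -/
theorem IsSolutionProcess.ae_volterraNoise_eq (h : CoefficientAssumption 1 cg cB A B)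
    (hγ : 0 < γ) (hcg : 0 ≤ cg) (hcB : 0 ≤ cB) (hμ : IsContinuousCurve μ)
    (hsol : IsSolutionProcess P γ σ H A B μ W X V) (hT : 0 ≤ T) :
    ∀ᵐ ω ∂P, ∃ z : C(Icc (0 : ℝ) T, Phase d), (∀ s : Icc (0 : ℝ) T, z s = (X s ω, V s ω)) ∧
      ∀ t : ℝ≥0, (t : ℝ) ≤ T → volterraNoise hT (drift γ H A B μ) z t =
        (X 0 ω, V 0 ω + √(2 * σ) • W t ω) := by
  obtain ⟨K, hK⟩ := exists_lipschitzWith_drift (H := H) h hγ hcg hcB hμ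
  filter_upwards [hsol.continuous_paths, hsol.position, hsol.velocity] with ω hc hx hv
  have hc1 := (hc.1.mono (Icc_subset_Ici_self : Icc 0 T ⊆ _)).domRestrict
  have hc2 := (hc.2.mono (Icc_subset_Ici_self : Icc 0 T ⊆ _)).domRestrict
  let z : C(Icc (0 : ℝ) T, Phase d) := ⟨fun s => (X s ω, V s ω), hc1.prodMk hc2⟩
  refine ⟨z, fun s => rfl, fun t ht => ?_⟩
  have hz : ∀ s ∈ Icc (0 : ℝ) T, IccExtend hT z s = (X s ω, V s ω) := fun s hs =>
    IccExtend_of_mem hT z hs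
  have hi := (continuous_comp_path hT (continuous_drift (γ := γ) (H := H) h hcB hμ) hK
    z).intervalIntegrable (μ := volume) 0 t
  have hsub : ∀ s ∈ uIcc (0 : ℝ) t, s ∈ Icc (0 : ℝ) T := fun s hs => by
    rw [uIcc_of_le t.coe_nonneg] at hs
    exact ⟨hs.1, hs.2.trans ht⟩
  have h1 : (∫ s in (0 : ℝ)..t, drift γ H A B μ s (IccExtend hT z s)).1 =
      ∫ s in (0 : ℝ)..t, V s ω := by
    rw [← ContinuousLinearMap.coe_fst' (R := ℝ) (M₁ := Space d) (M₂ := Space d),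
      ← ContinuousLinearMap.intervalIntegral_comp_comm _ hi]
    refine intervalIntegral.integral_congr fun s hs => ?_
    simp [drift, hz s (hsub s hs)]
  have h2 : (∫ s in (0 : ℝ)..t, drift γ H A B μ s (IccExtend hT z s)).2 =
      ∫ s in (0 : ℝ)..t, (A (X s ω) + interactionForce H B μ s (X s ω) - γ • V s ω) := by
    rw [← ContinuousLinearMap.coe_snd' (R := ℝ) (M₁ := Space d) (M₂ := Space d),
      ← ContinuousLinearMap.intervalIntegral_comp_comm _ hi]
    refine intervalIntegral.integral_congr fun s hs => ?_
    simp [drift, hz s (hsub s hs), interactionForce_eq_avgForce μ (hsub s hs).1]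
  rw [volterraNoise, hz t ⟨t.2, ht⟩]
  refine Prod.ext ?_ ?_
  · rw [Prod.fst_sub, h1, hx t]; simp
  · rw [Prod.snd_sub, h2, hv t]; simp only; abel

/-- The sampled noise `(x, v + c w_k)` with initial state `(x, v)`. -/
def sampledNoise (c : ℝ) (p : Phase d × (ℕ → Space d)) (k : ℕ) : Phase d :=
  (p.1.1, p.1.2 + c • p.2 k)

theorem measurable_sampledNoise (c : ℝ) : Measurable (sampledNoise (d := d) c) := by
  unfold sampledNoise
  fun_prop

theorem toNNReal_coe_Icc (s : Icc (0 : ℝ) T) : ((s : ℝ).toNNReal : ℝ) = s :=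
  Real.coe_toNNReal _ s.2.1

/-- Weak uniqueness, together with transfer of existence: on any probability space that carries a
copy of the sampled noise, the solution map recovers a solution with the laws `μ`. -/
theorem exists_solution_map [IsProbabilityMeasure P] (h : CoefficientAssumption 1 cg cB A B)
    (hγ : 0 < γ) (hcg : 0 ≤ cg) (hcB : 0 ≤ cB) (hμ : IsContinuousCurve μ)
    (hsol : IsSolutionProcess P γ σ H A B μ W X V)
    (hlaw : ∀ t, 0 ≤ t → P.map (fun ω => (X t ω, V t ω)) = μ t) (hT : 0 ≤ T)
    {q : ℕ → Icc (0 : ℝ) T} (hq : DenseRange q) :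
    ∃ Ψ : (ℕ → Phase d) → C(Icc (0 : ℝ) T, Phase d), (∀ s, Measurable fun y => Ψ y s) ∧
      ∀ {Ω' : Type v} [MeasurableSpace Ω'] (P' : Measure Ω') (N : Ω' → ℕ → Phase d),
        Measurable N →
        P'.map N = ((μ 0).prod (P.map fun ω k => W (q k : ℝ).toNNReal ω)).map
          (sampledNoise √(2 * σ)) →
        (∀ s : Icc (0 : ℝ) T, P'.map (fun ω => Ψ (N ω) s) = μ s) ∧
          ∀ᵐ ω ∂P', ∀ k, volterraNoise hT (drift γ H A B μ) (Ψ (N ω)) (q k) = N ω k := by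
  obtain ⟨K, hK⟩ := exists_lipschitzWith_drift (H := H) h hγ hcg hcB hμ
  obtain ⟨Ψ, hΨm, hΨ, hR⟩ := exists_measurable_solution_map hT
    (continuous_drift (γ := γ) (H := H) h hcB hμ) hK hq
  refine ⟨Ψ, hΨm, fun {Ω'} _ P' N hN hmap => ?_⟩
  have hWm := hsol.brownian.measurable
  have hX := hsol.measurable_X
  have hV := hsol.measurable_V
  let N₀ : Ω → ℕ → Phase d := fun ω =>
    sampledNoise √(2 * σ) ((X 0 ω, V 0 ω), fun k => W (q k : ℝ).toNNReal ω)
  have hZ0 : Measurable fun ω => (X 0 ω, V 0 ω) := (hX 0 le_rfl).prodMk (hV 0 le_rfl)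
  have hWq : Measurable fun ω k => W (q k : ℝ).toNNReal ω :=
    measurable_pi_lambda _ fun k => hWm _
  have hN₀ : Measurable N₀ := (measurable_sampledNoise _).comp (hZ0.prodMk hWq)
  have hmap₀ : P'.map N = P.map N₀ := by
    have hind : IndepFun (fun ω => (X 0 ω, V 0 ω)) (fun ω k => W (q k : ℝ).toNNReal ω) P :=
      hsol.initial_indep.comp measurable_id
        (ψ := fun (w : ℝ≥0 → Space d) (k : ℕ) => w (q k : ℝ).toNNReal) (by fun_prop)
    rw [hmap, ← hlaw 0 le_rfl,
      ← (indepFun_iff_map_prod_eq_prod_map_map hZ0.aemeasurable hWq.aemeasurable).1 hind,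
      Measure.map_map (measurable_sampledNoise _) (hZ0.prodMk hWq)]
    rfl
  have hgood : ∀ᵐ ω ∂P, (∀ s : Icc (0 : ℝ) T, Ψ (N₀ ω) s = (X s ω, V s ω)) ∧
      N₀ ω ∈ range fun z k => volterraNoise hT (drift γ H A B μ) z (q k) := by
    filter_upwards [hsol.ae_volterraNoise_eq h hγ hcg hcB hμ hT] with ω ⟨z, hz, hzn⟩
    have e : (fun k => volterraNoise hT (drift γ H A B μ) z (q k)) = N₀ ω := by
      funext k
      have := hzn (q k : ℝ).toNNReal (by rw [toNNReal_coe_Icc]; exact (q k).2.2)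
      rwa [toNNReal_coe_Icc] at this
    refine ⟨fun s => ?_, z, e⟩
    rw [← e, hΨ, hz]
  constructor
  · intro s
    have e1 : P'.map (fun ω => Ψ (N ω) s) = (P'.map N).map fun y => Ψ y s :=
      (Measure.map_map (hΨm s) hN).symm
    rw [e1, hmap₀, Measure.map_map (hΨm s) hN₀, ← hlaw s s.2.1]
    exact Measure.map_congr (hgood.mono fun ω hω => hω.1 s)
  · have hr : ∀ᵐ y ∂(P'.map N), y ∈ range fun z k => volterraNoise hT (drift γ H A B μ) z (q k) := by
      rw [hmap₀]
      exact (ae_map_iff hN₀.aemeasurable hR).2 (hgood.mono fun ω hω => hω.2)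
    filter_upwards [ae_of_ae_map hN.aemeasurable hr] with ω ⟨z, hz⟩ k
    rw [← hz, hΨ]

end SolutionLaw

/-! ### Decay along synchronous couplings -/

section Contraction

variable {d : ℕ} {cg cB γ H T : ℝ} {A : Space d → Space d} {B : Space d → Space d → Space d}
  {μ ν : ℝ → Measure (Phase d)}

theorem integrable_quadForm_sub {Ω : Type*} [MeasurableSpace Ω] {P : Measure Ω} (hγ : 0 < γ)
    {Z Z' : Ω → Phase d} {μ ν : Measure (Phase d)} (hμ : MemP2 μ) (hν : MemP2 ν)
    (hZ : Measurable Z) (hZ' : Measurable Z') (hl : P.map Z = μ) (hl' : P.map Z' = ν) :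
    Integrable (fun ω => quadForm (γ + 2 / γ) (2 / γ) (Z ω - Z' ω)) P := by
  refine ((hμ.integrable_sub hν hZ hZ' hl hl').const_mul (γ + 2 / γ + 1)).mono'
    ((continuous_quadForm _ _).measurable.comp (hZ.sub hZ')).aestronglyMeasurable
    (ae_of_all _ fun ω => ?_)
  rw [Real.norm_of_nonneg (quadForm_nonneg hγ _)]
  exact quadForm_le_sqLength hγ _

/-- Two solutions on one probability space that are driven by the same noise, so that the
difference of their Volterra noises is constant in time. -/
structure IsSynchronous {Ω : Type*} [MeasurableSpace Ω] (P : Measure Ω) (γ H : ℝ)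
    (A : Space d → Space d) (B : Space d → Space d → Space d) (μ ν : ℝ → Measure (Phase d))
    (hT : 0 ≤ T) (Z Z' : Ω → C(Icc (0 : ℝ) T, Phase d)) : Prop where
  measurable_left : ∀ s, Measurable fun ω => Z ω s
  measurable_right : ∀ s, Measurable fun ω => Z' ω s
  map_left : ∀ s : Icc (0 : ℝ) T, P.map (fun ω => Z ω s) = μ s
  map_right : ∀ s : Icc (0 : ℝ) T, P.map (fun ω => Z' ω s) = ν s
  noise : ∀ᵐ ω ∂P, ∀ t : Icc (0 : ℝ) T,
    volterraNoise hT (drift γ H A B μ) (Z ω) t - volterraNoise hT (drift γ H A B ν) (Z' ω) t =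
      Z ω ⟨0, left_mem_Icc.2 hT⟩ - Z' ω ⟨0, left_mem_Icc.2 hT⟩

variable {Ω : Type*} [MeasurableSpace Ω] {P : Measure Ω} [IsProbabilityMeasure P] {hT : 0 ≤ T}
  {Z Z' : Ω → C(Icc (0 : ℝ) T, Phase d)}

/-- The memory term: if `e^{λ s} E Q(Z_s - Z'_s) ≤ M` at all times `s`, then the times
`s ≥ t - H` seen by the delay satisfy `E |X_s - X'_s|² ≤ C M e^{-λ (t - H)}`, where
`C = 2γ / (4 + γ²)`. -/
theorem norm_avgForce_sub_le_of_bound (h : CoefficientAssumption 1 cg cB A B) (hγ : 0 < γ)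
    (hcB : 0 ≤ cB) (hH : 0 ≤ H) (hμ : IsContinuousCurve μ) (hν : IsContinuousCurve ν)
    (hs : IsSynchronous P γ H A B μ ν hT Z Z') {M l : ℝ} (hl : 0 ≤ l) (hM0 : 0 ≤ M)
    (hM : ∀ s : Icc (0 : ℝ) T, Real.exp (l * s) *
      ∫ ω, quadForm (γ + 2 / γ) (2 / γ) (Z ω s - Z' ω s) ∂P ≤ M)
    {t : ℝ} (ht : t ∈ Icc 0 T) (x x' : Space d) :
    ‖avgForce H B μ t x - avgForce H B ν t x'‖ ≤ cB * ‖x - x'‖ +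
      cB * √(2 * γ / (4 + γ ^ 2) * M * Real.exp (-l * (t - H))) := by
  refine norm_avgForce_sub_le h hcB hμ hν x x' fun u hu => ?_
  have hc0 : 0 ≤ cutoff H t := le_min ht.1 hH
  have hcH : cutoff H t ≤ H := min_le_right _ _
  have hcu : cutoff H t * u ≤ cutoff H t := mul_le_of_le_one_right hc0 hu.2
  have hcu0 : 0 ≤ cutoff H t * u := mul_nonneg hc0 hu.1
  obtain ⟨s, hs'⟩ : ∃ s : Icc (0 : ℝ) T, (s : ℝ) = max (t - cutoff H t * u) 0 :=
    ⟨⟨_, le_max_right _ _, max_le (by linarith [ht.2]) hT⟩, rfl⟩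
  have hle : t - H ≤ s := by
    rw [hs']; exact le_trans (by linarith) (le_max_left _ _)
  rw [← hs']
  have hμs := hμ.1 s s.2.1
  have hνs := hν.1 s s.2.1
  have hc := fun z => continuous_of_norm_sub_le hcB (h.interaction_right z)
  refine norm_integral_fst_sub_le (P := P) hμs hνs (hs.measurable_left s) (hs.measurable_right s)
    (hs.map_left s) (hs.map_right s) hcB (hc x) (hc x') (h.interaction_right x)
    (h.interaction_right x') (h.interaction_sub_le x x') ?_
  have hi := integrable_quadForm_sub hγ hμs hνs (hs.measurable_left s) (hs.measurable_right s)
    (hs.map_left s) (hs.map_right s)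
  have hq : ∫ ω, quadForm (γ + 2 / γ) (2 / γ) (Z ω s - Z' ω s) ∂P ≤ M * Real.exp (-l * (t - H)) := by
    have h1 := hM s
    have h2 : Real.exp (-(l * s)) ≤ Real.exp (-l * (t - H)) := by
      apply Real.exp_le_exp.2
      nlinarith
    calc _ = Real.exp (-(l * s)) * (Real.exp (l * s) *
          ∫ ω, quadForm (γ + 2 / γ) (2 / γ) (Z ω s - Z' ω s) ∂P) := by
          rw [← mul_assoc, ← Real.exp_add]; simp
      _ ≤ Real.exp (-(l * s)) * M := by gcongr
      _ ≤ Real.exp (-l * (t - H)) * M := by gcongr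
      _ = _ := mul_comm _ _
  calc _ ≤ ∫ ω, 2 * γ / (4 + γ ^ 2) * quadForm (γ + 2 / γ) (2 / γ) (Z ω s - Z' ω s) ∂P :=
        integral_mono_of_nonneg (ae_of_all _ fun ω => by positivity) (hi.const_mul _)
          (ae_of_all _ fun ω => norm_sq_le_quadForm hγ (Z ω s - Z' ω s))
    _ = 2 * γ / (4 + γ ^ 2) * ∫ ω, quadForm (γ + 2 / γ) (2 / γ) (Z ω s - Z' ω s) ∂P :=
        integral_const_mul _ _
    _ ≤ _ := by rw [mul_assoc]; gcongr

/-- An a priori bound `M` of `e^{λ s} E Q(Z_s - Z'_s)` on `[0, T]` improves itself. -/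
theorem IsSynchronous.exp_mul_integral_le (h : CoefficientAssumption 1 cg cB A B) (hγ : 0 < γ)
    (hcg : 0 ≤ cg) (hcB : 0 ≤ cB) (hηγ : cg + 2 * cB < γ)
    (hlt : lambdaTwo γ (cg + 2 * cB) < lambdaOne γ (cg + 2 * cB))
    (hH : 0 ≤ H) (hμ : IsContinuousCurve μ) (hν : IsContinuousCurve ν)
    (hs : IsSynchronous P γ H A B μ ν hT Z Z') {M : ℝ} (hM0 : 0 ≤ M)
    (hM : ∀ s : Icc (0 : ℝ) T, Real.exp (decayRate γ (cg + 2 * cB) H * s) *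
      ∫ ω, quadForm (γ + 2 / γ) (2 / γ) (Z ω s - Z' ω s) ∂P ≤ M)
    (t : Icc (0 : ℝ) T) :
    Real.exp (lambdaOne γ (cg + 2 * cB) * t) *
        ∫ ω, quadForm (γ + 2 / γ) (2 / γ) (Z ω t - Z' ω t) ∂P ≤
      ∫ ω, quadForm (γ + 2 / γ) (2 / γ)
          (Z ω ⟨0, left_mem_Icc.2 hT⟩ - Z' ω ⟨0, left_mem_Icc.2 hT⟩) ∂P
        + M * (Real.exp ((lambdaOne γ (cg + 2 * cB) - decayRate γ (cg + 2 * cB) H) * t) - 1) := by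
  have hη : 0 ≤ cg + 2 * cB := by positivity
  have hl := (decayRate_spec hγ hη hH hlt).1
  have hint : ∀ s : Icc (0 : ℝ) T,
      Integrable (fun ω => quadForm (γ + 2 / γ) (2 / γ) (Z ω s - Z' ω s)) P := fun s =>
    integrable_quadForm_sub hγ (hμ.1 s s.2.1) (hν.1 s s.2.1) (hs.measurable_left s)
      (hs.measurable_right s) (hs.map_left s) (hs.map_right s)
  obtain ⟨K, hK⟩ := exists_lipschitzWith_drift (H := H) h hγ hcg hcB hμ
  obtain ⟨K', hK'⟩ := exists_lipschitzWith_drift (H := H) h hγ hcg hcB hν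
  rw [← integral_const_mul]
  have hconst : ∀ c : ℝ, c = ∫ _ : Ω, c ∂P := fun c => by simp
  rw [hconst (M * _), ← MeasureTheory.integral_add (hint _) (integrable_const _)]
  refine integral_mono_ae ((hint t).const_mul _) ((hint _).add (integrable_const _)) ?_
  filter_upwards [hs.noise] with ω hω
  have hgc := continuous_comp_path hT (continuous_drift (γ := γ) (H := H) h hcB hμ) hK (Z ω)
  have hgc' := continuous_comp_path hT (continuous_drift (γ := γ) (H := H) h hcB hν) hK' (Z' ω)
  set z : ℝ → Phase d := IccExtend hT (Z ω) with hz
  set z' : ℝ → Phase d := IccExtend hT (Z' ω) with hz'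
  set g : ℝ → Phase d := fun s => drift γ H A B μ s (z s) - drift γ H A B ν s (z' s) with hg
  have hw : ∀ s ∈ Icc (0 : ℝ) T, z s - z' s =
      (Z ω ⟨0, left_mem_Icc.2 hT⟩ - Z' ω ⟨0, left_mem_Icc.2 hT⟩) + ∫ r in (0 : ℝ)..s, g r := by
    intro s hs
    have h1 := hω ⟨s, hs⟩
    rw [volterraNoise, volterraNoise] at h1
    rw [← h1, hg, intervalIntegral.integral_sub (hgc.intervalIntegrable 0 s)
      (hgc'.intervalIntegrable 0 s)]
    abel
  have hder : ∀ s ∈ Ioo (0 : ℝ) T, HasDerivAt (fun s => z s - z' s) (g s) s := fun s hs =>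
    (((hgc.sub hgc').integral_hasStrictDerivAt 0 s).hasDerivAt.const_add
      (Z ω ⟨0, left_mem_Icc.2 hT⟩ - Z' ω ⟨0, left_mem_Icc.2 hT⟩)).congr_of_eventuallyEq
      (eventually_of_mem (Icc_mem_nhds hs.1 hs.2) hw)
  have hzc : Continuous z := (Z ω).continuous.Icc_extend'
  have hzc' : Continuous z' := (Z' ω).continuous.Icc_extend'
  let G : ℝ → Space d := fun s => ((A (z s).1 - A (z' s).1) + ((z s).1 - (z' s).1)) +
    (avgForce H B μ s (z s).1 - avgForce H B ν s (z' s).1)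
  have key := exp_mul_quadForm_le (H := H) (T := t) (M := M) hγ hcg hcB hηγ hH hlt t.2.1 hM0
    (x := fun s => (z s - z' s).1) (v := fun s => (z s - z' s).2) (G := G)
    (by fun_prop) (by fun_prop)
    (fun s hs => by
      have := (ContinuousLinearMap.fst ℝ (Space d) (Space d)).hasFDerivAt.comp_hasDerivAt s
        (hder s ⟨hs.1, hs.2.trans_le t.2.2⟩)
      exact this)
    (fun s hs => by
      have := (ContinuousLinearMap.snd ℝ (Space d) (Space d)).hasFDerivAt.comp_hasDerivAt s
        (hder s ⟨hs.1, hs.2.trans_le t.2.2⟩)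
      refine this.congr_deriv ?_
      simp only [G, hg, drift, ContinuousLinearMap.coe_snd', Prod.snd_sub, Prod.fst_sub, smul_sub]
      abel)
    (fun s hs' => by
      have h1 := h.norm_force_sub_le (z s).1 (z' s).1
      have h2 := norm_avgForce_sub_le_of_bound h hγ hcB hH hμ hν hs hl.le hM0 hM
        ⟨hs'.1.le, hs'.2.le.trans t.2.2⟩ (z s).1 (z' s).1
      have h3 := norm_add_le ((A (z s).1 - A (z' s).1) + ((z s).1 - (z' s).1))
        (avgForce H B μ s (z s).1 - avgForce H B ν s (z' s).1)
      simp only [G, Prod.fst_sub]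
      linarith)
  have e1 : z t = Z ω t := IccExtend_val hT _ t
  have e2 : z' t = Z' ω t := IccExtend_val hT _ t
  have e3 : z 0 = Z ω ⟨0, left_mem_Icc.2 hT⟩ := IccExtend_of_mem hT _ _
  have e4 : z' 0 = Z' ω ⟨0, left_mem_Icc.2 hT⟩ := IccExtend_of_mem hT _ _
  simpa only [Prod.mk.eta, e1, e2, e3, e4] using key

/-- Decay in mean. With `M` the supremum of `e^{λ s} E Q(Z_s - Z'_s)` over `[0, T]`, the a priori
estimate gives `M ≤ θ q(0) + (1 - θ) M` for `θ = e^{-(λ₁ - λ) T} > 0`, hence `M ≤ q(0)`. -/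
theorem IsSynchronous.integral_le (h : CoefficientAssumption 1 cg cB A B) (hγ : 0 < γ)
    (hcg : 0 ≤ cg) (hcB : 0 ≤ cB) (hηγ : cg + 2 * cB < γ)
    (hlt : lambdaTwo γ (cg + 2 * cB) < lambdaOne γ (cg + 2 * cB))
    (hH : 0 ≤ H) (hμ : IsContinuousCurve μ) (hν : IsContinuousCurve ν)
    (hs : IsSynchronous P γ H A B μ ν hT Z Z') (t : Icc (0 : ℝ) T) :
    ∫ ω, quadForm (γ + 2 / γ) (2 / γ) (Z ω t - Z' ω t) ∂P ≤
      Real.exp (-decayRate γ (cg + 2 * cB) H * t) * ∫ ω, quadForm (γ + 2 / γ) (2 / γ)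
        (Z ω ⟨0, left_mem_Icc.2 hT⟩ - Z' ω ⟨0, left_mem_Icc.2 hT⟩) ∂P := by
  have hη : 0 ≤ cg + 2 * cB := by positivity
  obtain ⟨hl0, hl⟩ := decayRate_spec hγ hη hH hlt
  have hstep := fun M hM0 hM => hs.exp_mul_integral_le (M := M) h hγ hcg hcB hηγ hlt hH hμ hν hM0 hM
  have h20 := lambdaTwo_nonneg hγ hη
  set l := decayRate γ (cg + 2 * cB) H
  set l1 := lambdaOne γ (cg + 2 * cB)
  let q : Icc (0 : ℝ) T → ℝ := fun s => ∫ ω, quadForm (γ + 2 / γ) (2 / γ) (Z ω s - Z' ω s) ∂P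
  let o : Icc (0 : ℝ) T := ⟨0, left_mem_Icc.2 hT⟩
  have hq0 : ∀ s, 0 ≤ q s := fun s => integral_nonneg fun ω => quadForm_nonneg hγ _
  have hκ : 0 ≤ l1 - l := by rw [hl]; positivity
  have hbdd : BddAbove (range fun s : Icc (0 : ℝ) T => Real.exp (l * s) * q s) := by
    obtain ⟨C, hC⟩ := hμ.exists_second_moment_bound T
    obtain ⟨C', hC'⟩ := hν.exists_second_moment_bound T
    refine ⟨Real.exp (l * T) * ((γ + 2 / γ + 1) * (2 * C + 2 * C')), ?_⟩
    rintro _ ⟨s, rfl⟩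
    have hμs := hμ.1 s s.2.1
    have hνs := hν.1 s s.2.1
    have h1 := hμs.integral_sub_le hνs (hs.measurable_left s) (hs.measurable_right s)
      (hs.map_left s) (hs.map_right s)
    have h2 : q s ≤ (γ + 2 / γ + 1) * (2 * C + 2 * C') := by
      calc q s ≤ ∫ ω, (γ + 2 / γ + 1) * sqLength (Z ω s - Z' ω s) ∂P :=
            integral_mono (integrable_quadForm_sub hγ hμs hνs (hs.measurable_left s)
              (hs.measurable_right s) (hs.map_left s) (hs.map_right s))
              ((hμs.integrable_sub hνs (hs.measurable_left s)
              (hs.measurable_right s) (hs.map_left s) (hs.map_right s)).const_mul _)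
              fun ω => quadForm_le_sqLength hγ _
        _ = (γ + 2 / γ + 1) * ∫ ω, sqLength (Z ω s - Z' ω s) ∂P := integral_const_mul _ _
        _ ≤ _ := by
            gcongr
            linarith [hC s s.2, hC' s s.2]
    exact mul_le_mul (by gcongr; exact s.2.2) h2 (hq0 s) (Real.exp_pos _).le
  have hM : ∀ s : Icc (0 : ℝ) T, Real.exp (l * s) * q s ≤ sSup (range fun s : Icc (0 : ℝ) T => Real.exp (l * s) * q s) :=
    fun s => le_csSup hbdd ⟨s, rfl⟩
  set M := sSup (range fun s : Icc (0 : ℝ) T => Real.exp (l * s) * q s) with hMdef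
  have hoM : q o ≤ M := by simpa [o] using hM o
  have hM0 : 0 ≤ M := (hq0 o).trans hoM
  have hle : M ≤ Real.exp (-((l1 - l) * T)) * q o + (1 - Real.exp (-((l1 - l) * T))) * M := by
    have : Nonempty (Icc (0 : ℝ) T) := ⟨o⟩
    refine csSup_le (range_nonempty _) ?_
    rintro _ ⟨s, rfl⟩
    have h1 : Real.exp (l1 * s) * q s ≤ q o + M * (Real.exp ((l1 - l) * s) - 1) :=
      hstep M hM0 hM s
    have h2 : Real.exp (l * s) * q s ≤
        Real.exp (-((l1 - l) * s)) * q o + (1 - Real.exp (-((l1 - l) * s))) * M := by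
      have h3 := mul_le_mul_of_nonneg_left h1 (Real.exp_pos (-((l1 - l) * s))).le
      have e1 : Real.exp (-((l1 - l) * s)) * Real.exp (l1 * s) = Real.exp (l * s) := by
        rw [← Real.exp_add]; ring_nf
      have e2 : Real.exp (-((l1 - l) * s)) * Real.exp ((l1 - l) * s) = 1 := by
        rw [← Real.exp_add]; simp
      calc _ = Real.exp (-((l1 - l) * s)) * (Real.exp (l1 * s) * q s) := by
            rw [← mul_assoc, e1]
        _ ≤ _ := h3
        _ = Real.exp (-((l1 - l) * s)) * q o +
            (Real.exp (-((l1 - l) * s)) * Real.exp ((l1 - l) * s)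
              - Real.exp (-((l1 - l) * s))) * M := by ring
        _ = _ := by rw [e2]
    have h4 : Real.exp (-((l1 - l) * T)) ≤ Real.exp (-((l1 - l) * s)) := by
      gcongr; exact s.2.2
    have h5 := mul_le_mul_of_nonneg_right h4 (sub_nonneg.2 hoM)
    linarith
  have hMq : M ≤ q o := by
    have h1 : Real.exp (-((l1 - l) * T)) * M ≤ Real.exp (-((l1 - l) * T)) * q o := by linarith
    exact le_of_mul_le_mul_left h1 (Real.exp_pos _)
  have h1 := (hM t).trans hMq
  have h2 := mul_le_mul_of_nonneg_left h1 (Real.exp_pos (-l * t)).le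
  rw [← mul_assoc, ← Real.exp_add] at h2
  simpa [q, o] using h2

end Contraction

/-! ### Contraction of the transport distance -/

/-- Every coupling of the initial laws extends to a synchronous coupling of the solutions. -/
theorem exists_synchronous {d : ℕ} {cg cB γ σ H T : ℝ} {A : Space d → Space d}
    {B : Space d → Space d → Space d} (h : CoefficientAssumption 1 cg cB A B)
    (hγ : 0 < γ) (hcg : 0 ≤ cg) (hcB : 0 ≤ cB) {μ ν : ℝ → Measure (Phase d)}
    (hμ : IsMeanFieldSolution.{u} γ σ H A B μ) (hν : IsMeanFieldSolution.{v} γ σ H A B ν)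
    (hT : 0 ≤ T) {π : Measure (Phase d × Phase d)} (hπ : π ∈ couplings (μ 0) (ν 0)) :
    ∃ (Ω : Type u) (_ : MeasurableSpace Ω) (P : Measure Ω) (_ : IsProbabilityMeasure P)
      (Z Z' : Ω → C(Icc (0 : ℝ) T, Phase d)), IsSynchronous P γ H A B μ ν hT Z Z' ∧
        P.map (fun ω => Z ω ⟨0, left_mem_Icc.2 hT⟩ - Z' ω ⟨0, left_mem_Icc.2 hT⟩) =
          π.map fun p => p.1 - p.2 := by
  obtain ⟨hμc, Ω₁, _, P₁, _, W₁, X₁, V₁, hsol₁, hlaw₁⟩ := hμ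
  obtain ⟨hνc, Ω₂, _, P₂, _, W₂, X₂, V₂, hsol₂, hlaw₂⟩ := hν
  have : Nonempty (Icc (0 : ℝ) T) := ⟨⟨0, left_mem_Icc.2 hT⟩⟩
  let q := TopologicalSpace.denseSeq (Icc (0 : ℝ) T)
  have hq : DenseRange q := TopologicalSpace.denseRange_denseSeq _
  have hπp : IsProbabilityMeasure π := by
    have := (hμc.1 0 le_rfl).1
    rw [← hπ.1] at this
    exact Measure.isProbabilityMeasure_of_map Prod.fst
  have hWq : Measurable fun ω k => W₁ (q k : ℝ).toNNReal ω :=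
    measurable_pi_lambda _ fun k => hsol₁.brownian.measurable _
  obtain ⟨Ψ, hΨm, hΨ⟩ := exists_solution_map.{u, u} h hγ hcg hcB hμc hsol₁ hlaw₁ hT hq
  obtain ⟨Ψ', hΨm', hΨ'⟩ := exists_solution_map.{v, u} h hγ hcg hcB hνc hsol₂ hlaw₂ hT hq
  let c : ℝ := √(2 * σ)
  -- both solutions are rebuilt from independent data: the coupled initial states, and the Brownian
  -- motion of the first solution, which has the law of that of the second
  let P : Measure ((Phase d × Phase d) × Ω₁) := π.prod P₁
  let N : (Phase d × Phase d) × Ω₁ → ℕ → Phase d := fun p =>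
    sampledNoise c (p.1.1, fun k => W₁ (q k : ℝ).toNNReal p.2)
  let N' : (Phase d × Phase d) × Ω₁ → ℕ → Phase d := fun p =>
    sampledNoise c (p.1.2, fun k => W₁ (q k : ℝ).toNNReal p.2)
  have hp : Measurable (Prod.map Prod.fst fun ω k => W₁ (q k : ℝ).toNNReal ω :
      (Phase d × Phase d) × Ω₁ → Phase d × (ℕ → Space d)) := measurable_fst.prodMap hWq
  have hp' : Measurable (Prod.map Prod.snd fun ω k => W₁ (q k : ℝ).toNNReal ω :
      (Phase d × Phase d) × Ω₁ → Phase d × (ℕ → Space d)) := measurable_snd.prodMap hWq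
  have hN : Measurable N := (measurable_sampledNoise c).comp hp
  have hN' : Measurable N' := (measurable_sampledNoise c).comp hp'
  have hmap : P.map N = ((μ 0).prod (P₁.map fun ω k => W₁ (q k : ℝ).toNNReal ω)).map
      (sampledNoise c) := by
    rw [← hπ.1, Measure.map_prod_map π P₁ measurable_fst hWq,
      Measure.map_map (measurable_sampledNoise c) hp]
    rfl
  have hmap' : P.map N' = ((ν 0).prod (P₂.map fun ω k => W₂ (q k : ℝ).toNNReal ω)).map
      (sampledNoise c) := by
    rw [← hπ.2, ← hsol₁.brownian.map_eq hsol₂.brownian fun k => (q k : ℝ).toNNReal,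
      Measure.map_prod_map π P₁ measurable_snd hWq,
      Measure.map_map (measurable_sampledNoise c) hp']
    rfl
  obtain ⟨hl, hn⟩ := hΨ P N hN hmap
  obtain ⟨hl', hn'⟩ := hΨ' P N' hN' hmap'
  obtain ⟨K, hK⟩ := exists_lipschitzWith_drift (H := H) h hγ hcg hcB hμc
  obtain ⟨K', hK'⟩ := exists_lipschitzWith_drift (H := H) h hγ hcg hcB hνc
  have hdiff : ∀ᵐ p ∂P, ∀ t : Icc (0 : ℝ) T,
      volterraNoise hT (drift γ H A B μ) (Ψ (N p)) t -
        volterraNoise hT (drift γ H A B ν) (Ψ' (N' p)) t = p.1.1 - p.1.2 := by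
    filter_upwards [hn, hn'] with p h1 h2
    -- the Brownian parts cancel at the sampled times, and both noises are continuous in time
    refine congrFun (Continuous.ext_on hq
      (((continuous_volterraNoise_path hT (continuous_drift h hcB hμc) hK _).comp
        continuous_subtype_val).sub
      ((continuous_volterraNoise_path hT (continuous_drift h hcB hνc) hK' _).comp
        continuous_subtype_val)) continuous_const (forall_mem_range.2 fun k => ?_))
    have h3 : volterraNoise hT (drift γ H A B μ) (Ψ (N p)) (q k) -
        volterraNoise hT (drift γ H A B ν) (Ψ' (N' p)) (q k) = p.1.1 - p.1.2 := by
      rw [h1 k, h2 k]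
      simp only [N, N', sampledNoise]
      refine Prod.ext rfl ?_
      simp
    exact h3
  have hinit : ∀ᵐ p ∂P, Ψ (N p) ⟨0, left_mem_Icc.2 hT⟩ - Ψ' (N' p) ⟨0, left_mem_Icc.2 hT⟩ =
      p.1.1 - p.1.2 := by
    filter_upwards [hdiff] with p h1
    have := h1 ⟨0, left_mem_Icc.2 hT⟩
    simpa [volterraNoise, IccExtend_of_mem hT _ (left_mem_Icc.2 hT)] using this
  refine ⟨_, inferInstance, P, inferInstance, fun p => Ψ (N p), fun p => Ψ' (N' p),
    ⟨fun s => (hΨm s).comp hN, fun s => (hΨm' s).comp hN', hl, hl', ?_⟩, ?_⟩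
  · filter_upwards [hdiff, hinit] with p h1 h2 t
    rw [h1 t, h2]
  · rw [Measure.map_congr hinit]
    have e : (π.prod P₁).map Prod.fst = π := by simp
    conv_rhs => rw [← e, Measure.map_map (by fun_prop) measurable_fst]
    rfl

/-- The synchronous coupling at time `T` has transport cost at most `e^{-λ T}` times that of the
initial coupling. -/
theorem exists_coupling_le {d : ℕ} {cg cB γ σ H T : ℝ} {A : Space d → Space d}
    {B : Space d → Space d → Space d} (h : CoefficientAssumption 1 cg cB A B)
    (hγ : 0 < γ) (hcg : 0 ≤ cg) (hcB : 0 ≤ cB) (hηγ : cg + 2 * cB < γ)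
    (hlt : lambdaTwo γ (cg + 2 * cB) < lambdaOne γ (cg + 2 * cB)) (hH : 0 ≤ H)
    {μ ν : ℝ → Measure (Phase d)}
    (hμ : IsMeanFieldSolution.{u} γ σ H A B μ) (hν : IsMeanFieldSolution.{v} γ σ H A B ν)
    (hT : 0 ≤ T) {π : Measure (Phase d × Phase d)} (hπ : π ∈ couplings (μ 0) (ν 0)) :
    ∃ π' ∈ couplings (μ T) (ν T),
      ∫⁻ p, ENNReal.ofReal (quadForm (γ + 2 / γ) (2 / γ) (p.1 - p.2)) ∂π' ≤
        ENNReal.ofReal (Real.exp (-decayRate γ (cg + 2 * cB) H * T)) *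
          ∫⁻ p, ENNReal.ofReal (quadForm (γ + 2 / γ) (2 / γ) (p.1 - p.2)) ∂π := by
  obtain ⟨Ω, _, P, _, Z, Z', hs, hinit⟩ := exists_synchronous h hγ hcg hcB hμ hν hT hπ
  let o : Icc (0 : ℝ) T := ⟨0, left_mem_Icc.2 hT⟩
  let τ : Icc (0 : ℝ) T := ⟨T, right_mem_Icc.2 hT⟩
  have hm := fun s => (hs.measurable_left s).prodMk (hs.measurable_right s)
  have hQ : Measurable fun z : Phase d => ENNReal.ofReal (quadForm (γ + 2 / γ) (2 / γ) z) := by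
    fun_prop
  have hlint : ∀ s : Icc (0 : ℝ) T,
      ∫⁻ ω, ENNReal.ofReal (quadForm (γ + 2 / γ) (2 / γ) (Z ω s - Z' ω s)) ∂P =
        ENNReal.ofReal (∫ ω, quadForm (γ + 2 / γ) (2 / γ) (Z ω s - Z' ω s) ∂P) := fun s =>
    (ofReal_integral_eq_lintegral_ofReal
      (integrable_quadForm_sub hγ (hμ.1.1 s s.2.1) (hν.1.1 s s.2.1) (hs.measurable_left s)
        (hs.measurable_right s) (hs.map_left s) (hs.map_right s))
      (ae_of_all _ fun ω => quadForm_nonneg hγ _)).symm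
  refine ⟨P.map fun ω => (Z ω τ, Z' ω τ), ⟨?_, ?_⟩, ?_⟩
  · rw [Measure.map_map measurable_fst (hm τ)]
    exact hs.map_left τ
  · rw [Measure.map_map measurable_snd (hm τ)]
    exact hs.map_right τ
  · rw [lintegral_map (by fun_prop) (hm τ)]
    have e0 : ∫⁻ p, ENNReal.ofReal (quadForm (γ + 2 / γ) (2 / γ) (p.1 - p.2)) ∂π =
        ∫⁻ ω, ENNReal.ofReal (quadForm (γ + 2 / γ) (2 / γ) (Z ω o - Z' ω o)) ∂P := by
      rw [← lintegral_map (g := fun p : Phase d × Phase d => p.1 - p.2) hQ (by fun_prop), ← hinit,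
        lintegral_map (g := fun ω => Z ω o - Z' ω o) hQ
          ((hs.measurable_left o).sub (hs.measurable_right o))]
    rw [e0, hlint o, hlint τ, ← ENNReal.ofReal_mul (Real.exp_pos _).le]
    exact ENNReal.ofReal_le_ofReal (hs.integral_le h hγ hcg hcB hηγ hlt hH hμ.1 hν.1 τ)

end DelayVFP

theorem mainTheorem1 (γ : ℝ) (hγ : 0 < γ) :
    ∃ a b η₀ : ℝ, 0 < a ∧ 0 < b ∧ 0 < η₀ ∧
      (∀ (d : ℕ) (z : Phase d), z ≠ 0 → 0 < quadForm a b z) ∧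
      ∀ cg cB : ℝ, 0 ≤ cg → 0 ≤ cB → cg + 2 * cB < η₀ → ∀ H : ℝ, 0 ≤ H →
        0 < decayRate γ (cg + 2 * cB) H ∧
        ∀ (d : ℕ) (σ : ℝ) (A : Space d → Space d) (B : Space d → Space d → Space d),
          0 ≤ σ → CoefficientAssumption 1 cg cB A B →
          ∀ μ ν : ℝ → Measure (Phase d),
            IsMeanFieldSolution.{u} γ σ H A B μ → IsMeanFieldSolution.{v} γ σ H A B ν →
            ∀ t : ℝ, 0 ≤ t →
              distQ a b (μ t) (ν t) ^ 2 ≤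
                ENNReal.ofReal (Real.exp (-decayRate γ (cg + 2 * cB) H * t)) *
                  distQ a b (μ 0) (ν 0) ^ 2 := by
  obtain ⟨η₀, hη₀, hη₀γ, hlt⟩ := exists_lambdaTwo_lt_lambdaOne hγ
  refine ⟨γ + 2 / γ, 2 / γ, η₀, by positivity, by positivity, hη₀,
    fun d z hz => quadForm_pos hγ hz, fun cg cB hcg hcB hη H hH => ?_⟩
  have hlt := hlt _ (by positivity) hη
  refine ⟨(decayRate_spec hγ (by positivity) hH hlt).1, fun d σ A B _ h μ ν hμ hν t ht => ?_⟩
  rw [distQ, distQ, transportDist_sq, transportDist_sq,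
    ENNReal.mul_iInf_of_ne (ENNReal.ofReal_pos.2 (Real.exp_pos _)).ne' ENNReal.ofReal_ne_top]
  refine le_iInf fun π => ?_
  rw [ENNReal.mul_iInf_of_ne (ENNReal.ofReal_pos.2 (Real.exp_pos _)).ne' ENNReal.ofReal_ne_top]
  refine le_iInf fun hπ => ?_
  obtain ⟨π', hπ', hle⟩ := exists_coupling_le h hγ hcg hcB (hη.trans_le hη₀γ) hlt hH hμ hν ht hπ
  exact (iInf₂_le π' hπ').trans hle
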